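/- **Itô–Davie formula for RDEs.** Let $\gamma\in(0,1)$, $N_\gamma=\lfloor\gamma^{-1}\rfloor$, $T>0$, and let $\mathbf W\colon[0,T]\to G^{(N_\gamma)}$ be a (weakly) geometric $\gamma$-Hölder rough path over $\mathbb R^d$, i.e. a path of step-$N_\gamma$ truncated characters of the shuffle algebra which is $\gamma$-Hölder for the homogeneous distance. Put $\mathbf W_{st}=\mathbf W_s^{-1}\star\mathbf W_t$, where $\langle g\star h,e_w\rangle=\sum_{uv=w}\langle g,e_u\rangle\langle h,e_v\rangle$. Let $f_1,\dots,f_d\colon\mathbb R^n\to\mathbb R^n$ be vector fields of class $C^{N_\gamma}$. Define $F_\varepsilon=\mathrm{id}$, $F_{iw}(x)=DF_w(x)f_i(x)$, and the differential operators $\Gamma_i\phi(x)=D\phi(x)f_i(x)$, $\Gamma_w=\Gamma_{i_1}\circ\dots\circ\Gamma_{i_m}$ for a word $w=i_1\cdots i_m$, $\Gamma_\varepsilon=\mathrm{id}$. Let $X\colon[0,T]\to\mathbb R^n$ be a solution of $dX_t=\sum_{i=1}^d f_i(X_t)\,d\mathbf W^i_t$, $X_0=x$, in the following sense. There is a path $\mathbf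 X$ controlled by $\mathbf W$ with $\langle\mathbf 1^*,\mathbf X_t\rangle=X_t$: its coordinates $\langle e_w^*,\mathbf X_t\rangle\in\mathbb R^n$, $|w|\le N_\gamma-1$, are $\gamma$-Hölder and satisfy $$\Big|\langle e_w^*,\mathbf X_t\rangle-\sum_{|v|\le N_\gamma-1-|w|}\langle e_{vw}^*,\mathbf X_s\rangle\langle\mathbf W_{st},e_v\rangle\Big|\lesssim|t-s|^{(N_\gamma-|w|)\gamma},\qquad s<t .$$ It starts from $\langle e_w^*,\mathbf X_0\rangle=F_w(x)$ for $|w|\le N_\gamma-1$, and, as controlled paths, $$\mathbf X_t-\mathbf X_s=\sum_{i=1}^d\int_s^t\mathbf F_i(\mathbf X)_u\,d\mathbf W^i_u\qquad\text{for all }s,t\in[0,T].$$ Here $\mathbf F_i(\mathbf X)$ is the composition of $\mathbf X$ with $f_i$: $\langle\mathbf 1^*,\mathbf F_i(\mathbf X)_t\rangle=f_i(X_t)$ and, for $w\ne\varepsilon$, $$\langle e_w^*,\mathbf F_i(\mathbf X)_t\rangle=\sum_{k=1}^{|w|}\frac1{k!}\sum_{u_1,\dots,u_k\neq\varepsilon}c(w;u_1,\dots,u_k)\,D^kf_i(X_t)\big(\langle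 e_{u_1}^*,\mathbf X_t\rangle,\dots,\langle e_{u_k}^*,\mathbf X_t\rangle\big),$$ where $c(w;u_1,\dots,u_k)$ is the coefficient of $e_w$ in the shuffle product of $e_{u_1},\dots,e_{u_k}$. For a path $\mathbf Y$ controlled by $\mathbf W$, the integral $\int_0^t\mathbf Y_u\,d\mathbf W^i_u$ has as its coordinate at $\varepsilon$ the rough integral $\lim_{|\pi|\to0}\sum_{[a,b]\in\pi}\sum_{|w|\le N_\gamma-1}\langle e_w^*,\mathbf Y_a\rangle\langle\mathbf W_{ab},e_{wi}\rangle$ over partitions $\pi$ of $[0,t]$, as its coordinate at $wi$ the value $\langle e_w^*,\mathbf Y_t\rangle$, and zero elsewhere; $\int_s^t=\int_0^t-\int_0^s$. Then for every $\phi\in C_b^{N_\gamma+1}(\mathbb R^n)$ and every word $w$ with $|w|\le N_\gamma$ there is a constant $C$ such that for all $s,t\in[0,T]$ $$\Big|\Gamma_w\phi(X_t)-\sum_{0\le|v|\le N_\gamma-|w|}\Gamma_{vw}\phi(X_s)\,\langle\mathbf W_{st},e_v\rangle\Big|\le C\,|t-s|^{(N_\gamma+1-|w|)\gamma}.$$ 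-/

import Mathlib

open Set
open scoped NNReal

noncomputable section

namespace RoughIto

/-- Words over the alphabet `{1, …, d}`; `[]` is the empty word, `++` is concatenation. -/
abbrev Word (d : ℕ) := List (Fin d)

/-- The finite set of words of length at most `N`. -/
def wordsLE (d N : ℕ) : Finset (Word d) :=
  (Finset.range (N + 1)).biUnion fun k =>
    (Finset.univ : Finset (Fin k → Fin d)).image List.ofFn

theorem mem_wordsLE {d N : ℕ} {w : Word d} : w ∈ wordsLE d N ↔ w.length ≤ N := by
  simp only [wordsLE, Finset.mem_biUnion, Finset.mem_range, Finset.mem_image, Finset.mem_univ,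
    true_and]
  constructor
  · rintro ⟨k, hk, v, rfl⟩
    simp only [List.length_ofFn]
    omega
  · intro h
    exact ⟨w.length, by omega, w.get, List.ofFn_get w⟩

/-! ### Shuffles and truncated characters

An element of the step-`N` truncated tensor algebra, or of its dual, is represented by its family
of coordinates in the basis of words.  The coordinates are written as a function on all words;
the definitions only ever read it on words of length at most `N`. -/

/-- The words occurring in the shuffle product of two words, listed with multiplicity. -/
def shuffle {α : Type*} : List α → List α → List (List α)
  | [], v => [v]
  | a :: u, [] => [a :: u]
  | a :: u, b :: v =>
      (shuffle u (b :: v)).map (fun w => a :: w) ++ (shuffle (a :: u) v).map (fun w => b :: w)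
termination_by u v => u.length + v.length

/-- The words occurring in the shuffle product of finitely many words, with multiplicity. -/
def shuffleAll {α : Type*} : List (List α) → List (List α)
  | [] => [[]]
  | u :: us => (shuffleAll us).flatMap fun w => shuffle u w

/-- The coefficient of the word `w` in the shuffle product of the words `u 0, …, u (k-1)`. -/
def shuffleCoeff {d k : ℕ} (w : Word d) (u : Fin k → Word d) : ℕ :=
  (shuffleAll (List.ofFn u)).count w

/-- Step-`N` truncated characters. -/
structure IsTruncatedCharacter {d : ℕ} (N : ℕ) (g : Word d → ℝ) : Prop where
  one : g [] = 1
  mul : ∀ u v : Word d, u.length + v.length ≤ N → ((shuffle u v).map g).sum = g u * g v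

/-- The convolution product `⟨g ⋆ h, e_w⟩ = ∑_{uv = w} ⟨g, e_u⟩ ⟨h, e_v⟩`. -/
def conv {d : ℕ} (g h : Word d → ℝ) (w : Word d) : ℝ :=
  ∑ k ∈ Finset.range (w.length + 1), g (w.take k) * h (w.drop k)

/-- The inverse `g ∘ S` of a character, `S` being the antipode
`S e_{i₁…i_p} = (-1)^p e_{i_p…i₁}`. -/
def inv {d : ℕ} (g : Word d → ℝ) (w : Word d) : ℝ :=
  (-1) ^ w.length * g w.reverse

/-- The homogeneous norm `max_{0 < |w| ≤ N} (|w|! |⟨g, e_w⟩|)^{1/|w|}`; it is sub-additive, and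
symmetric on characters. -/
def homNorm {d : ℕ} (N : ℕ) (g : Word d → ℝ) : ℝ≥0 :=
  ((wordsLE d N).filter fun w => w ≠ []).sup fun w =>
    ((Nat.factorial w.length : ℝ≥0) * ‖g w‖₊) ^ (1 / (w.length : ℝ))

/-- The left invariant distance `‖h⁻¹ ⋆ g‖` on the truncated characters. -/
def homDist {d : ℕ} (N : ℕ) (g h : Word d → ℝ) : ℝ≥0 :=
  homNorm N (conv (inv h) g)

/-! ### Rough paths and controlled paths -/

/-- `N_γ = ⌊1/γ⌋`. -/
def level (γ : ℝ) : ℕ := ⌊γ⁻¹⌋₊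

/-- The increment `W_{st} = W_s⁻¹ ⋆ W_t`. -/
def incr {d : ℕ} (W : ℝ → Word d → ℝ) (s t : ℝ) : Word d → ℝ :=
  conv (inv (W s)) (W t)

/-- (Weakly) geometric rough paths of regularity `γ` on `[0, T]`: paths with values in the
step-`N_γ` truncated characters which are `γ`-Hölder for the homogeneous distance. -/
structure IsGeometricRoughPath {d : ℕ} (γ T : ℝ) (W : ℝ → Word d → ℝ) : Prop where
  character : ∀ t ∈ Icc 0 T, IsTruncatedCharacter (level γ) (W t)
  holder : ∃ C : ℝ, ∀ s ∈ Icc 0 T, ∀ t ∈ Icc 0 T,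
    (homDist (level γ) (W t) (W s) : ℝ) ≤ C * |t - s| ^ γ

variable {d : ℕ} {E F : Type*} [NormedAddCommGroup E] [NormedSpace ℝ E]
  [NormedAddCommGroup F] [NormedSpace ℝ F]

/-- `Y`, with coordinates `⟨e_w^*, Y_t⟩ = Y t w` for `|w| ≤ N - 1`, is a path controlled by `W`,
of order `N`: all its coordinates are `γ`-Hölder, and `⟨e_w^*, Y_t⟩` agrees with
`⟨W_{st} ⋆ e_w^*, Y_s⟩ = ∑_v ⟨W_{st}, e_v⟩ ⟨e_{vw}^*, Y_s⟩` to order `(N - |w|) γ`. -/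
structure IsControlled (γ T : ℝ) (W : ℝ → Word d → ℝ) (N : ℕ) (Y : ℝ → Word d → E) : Prop where
  holder : ∀ w : Word d, w.length < N → ∃ C : ℝ, ∀ s ∈ Icc 0 T, ∀ t ∈ Icc 0 T,
    ‖Y t w - Y s w‖ ≤ C * |t - s| ^ γ
  remainder : ∀ w : Word d, w.length < N → ∃ C : ℝ, ∀ s ∈ Icc 0 T, ∀ t ∈ Icc 0 T, s < t →
    ‖Y t w - ∑ v ∈ wordsLE d (N - 1 - w.length), incr W s t v • Y s (v ++ w)‖
      ≤ C * |t - s| ^ (((N : ℝ) - w.length) * γ)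

/-- The coordinates of the composition `Φ(Y)` of a controlled path with a function `φ`, at a time
where `Y` has coordinates `y`. The inner sum runs over `k`-tuples of non-empty words, weighted by
the multiplicity of `w` in their shuffle product. -/
def compLift (φ : E → F) (y : Word d → E) (w : Word d) : F :=
  if w = [] then φ (y [])
  else ∑ k ∈ Finset.Icc 1 w.length, ((Nat.factorial k : ℝ)⁻¹) •
    ∑ u ∈ Fintype.piFinset (fun _ : Fin k => (wordsLE d w.length).filter fun v => v ≠ []),
      (shuffleCoeff w u : ℝ) • iteratedFDeriv ℝ k φ (y []) (fun j => y (u j))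

/-- `J` is the rough integral `∫_0^t Y dW^i`: the limit of the compensated Riemann sums
`∑_{[a,b] ∈ π} ∑_{|w| ≤ N_γ - 1} ⟨e_w^*, Y_a⟩ ⟨W_{ab}, e_{wi}⟩` over the partitions
`0 = p 0 ≤ p 1 ≤ ⋯ ≤ p m = t`, as the mesh tends to zero. -/
def HasRoughIntegral (γ : ℝ) (W : ℝ → Word d → ℝ) (i : Fin d) (Y : ℝ → Word d → E) (t : ℝ)
    (J : E) : Prop :=
  ∀ ε > 0, ∃ δ > 0, ∀ (m : ℕ) (p : ℕ → ℝ), Monotone p → p 0 = 0 → p m = t →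
    (∀ k < m, p (k + 1) - p k < δ) →
    ‖(∑ k ∈ Finset.range m, ∑ w ∈ wordsLE d (level γ - 1),
        incr W (p k) (p (k + 1)) (w ++ [i]) • Y (p k) w) - J‖ < ε

/-- The coordinates of the controlled path `∫_0^t Y dW^i`, where `J` is the value of the rough
integral and `y` are the coordinates of `Y_t`: the coordinate at the empty word is `J`, the one at
`w i` is `⟨e_w^*, Y_t⟩`, all others vanish. -/
def integralLift (i : Fin d) (J : E) (y : Word d → E) (w : Word d) : E :=
  if w = [] then J else if w.getLast? = some i then y w.dropLast else 0

/-! ### Rough differential equations -/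

/-- `Γ_i φ = f_i · Dφ`. -/
def gamma (f : Fin d → E → E) (i : Fin d) (φ : E → F) : E → F :=
  fun x => fderiv ℝ φ x (f i x)

/-- `Γ_w = Γ_{i₁} ∘ ⋯ ∘ Γ_{i_m}` for `w = i₁ ⋯ i_m`, and `Γ_ε = id`. -/
def gammaWord (f : Fin d → E → E) : Word d → (E → F) → E → F
  | [], φ => φ
  | i :: w, φ => gamma f i (gammaWord f w φ)

/-- The functions `F_ε = id`, `F_{iw}(x) = DF_w(x) f_i(x)`. -/
def field (f : Fin d → E → E) : Word d → E → E
  | [] => id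
  | i :: w => fun x => fderiv ℝ (field f w) x (f i x)

/-- `X` solves `dX_t = ∑ᵢ f_i(X_t) dW^i_t` on `[0, T]`, `X_0 = x`: it is the trace of a controlled
path `Y` of order `N_γ`, started from `∑_{|w| ≤ N_γ - 1} F_w(x) e_w`, such that
`Y_t - Y_s = ∑ᵢ ∫_s^t F_i(Y)_u dW^i_u` as controlled paths, `F_i(Y)` being the composition of `Y`
with `f_i`. -/
def IsRDESolution (γ T : ℝ) (W : ℝ → Word d → ℝ) (f : Fin d → E → E) (x : E) (X : ℝ → E) :
    Prop :=
  ∃ Y : ℝ → Word d → E,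
    IsControlled γ T W (level γ) Y ∧
    (∀ t ∈ Icc 0 T, Y t [] = X t) ∧
    (∀ w : Word d, w.length < level γ → Y 0 w = field f w x) ∧
    ∃ J : Fin d → ℝ → E,
      (∀ i, ∀ t ∈ Icc 0 T, HasRoughIntegral γ W i (fun u => compLift (f i) (Y u)) t (J i t)) ∧
      ∀ s ∈ Icc 0 T, ∀ t ∈ Icc 0 T, ∀ w : Word d, w.length < level γ →
        Y t w - Y s w =
          ∑ i, (integralLift i (J i t) (compLift (f i) (Y t)) w
            - integralLift i (J i s) (compLift (f i) (Y s)) w)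

/-- `φ` is of class `C^r_b`: `r` times continuously differentiable, bounded together with its
derivatives of order at most `r`. -/
def IsCb (r : ℕ) (φ : E → F) : Prop :=
  ContDiff ℝ r φ ∧ ∀ k ≤ r, ∃ C : ℝ, ∀ x, ‖iteratedFDeriv ℝ k φ x‖ ≤ C

end RoughIto

end

/-! Write N for `level γ` and measure orders in powers of |t - s|^γ. The higher coordinates of a
solution are forced: at the word ui, the increment equation says that the coordinate moves like the
coordinate at u of the composition with f_i, so by induction on length the coordinate at w is
F_w(X_t) (`coord_eq_field`). The induction rests on an algebraic identity, `compLift_field`: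
composing the family (F_v(x))_v with φ gives the family (Γ_w φ(x))_w. This is a Faà di Bruno
formula. Differentiating it in direction f_j produces Leibniz terms that match the recursion of the
shuffle coefficients on the first letter (`sum_shuffleCoeff_cons`).

The same identity transfers expansions from X to functions of X (`isBigO_sub_sum_gammaWord`). If X_t
is the sum of F_v(X_s)⟨W_st, e_v⟩ over |v| ≤ K up to order K + 1, insert this in the Taylor
polynomial of ψ. Since W_st is a character, products of its coordinates are sums over shuffles, and
the coefficients reassemble into Γ_v ψ(X_s).

What remains is to expand X itself up to order N + 1 (`IsRDESolution.davie`), one order better than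
being controlled provides. The rough integral of f_i is approximated locally by the sum of
F_{wi}(X_s)⟨W_st, e_{wi}⟩ over |w| ≤ N - 1. By Chen's relation and the transfer applied to f_i with
the order-N expansion, the failure of additivity of this germ has order N + 1, and (N + 1)γ > 1. The
sewing estimate (`norm_partitionLimit_sub_le`) then bounds the distance from the integral to the
germ.

The transfer now gives the formula for s < t. For t < s, the reversed remainder is a combination of
forward remainders at longer words, because W_st and W_ts are inverse to each other
(`sub_sum_incr_reverse`). -/

noncomputable section

namespace RoughIto

/-! ### Shuffle sums, shuffle coefficients and characters. -/

section

variable {d : ℕ}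

/-! ### Sums over shuffles -/

/-- The sum of `g` over the words of the shuffle product of `u` and `v`. -/
def shSum {α : Type*} (g : List α → ℝ) (u v : List α) : ℝ := ((shuffle u v).map g).sum

/-- The sum of `g` over the words of the shuffle product of a list of words. -/
def shSumAll {α : Type*} (g : List α → ℝ) (us : List (List α)) : ℝ :=
  ((shuffleAll us).map g).sum

/-- The function `h` of the tail on words starting with the letter `j`, and zero on others. -/
def strip (j : Fin d) (h : Word d → ℝ) : Word d → ℝ
  | [] => 0
  | a :: z => if a = j then h z else 0

@[simp] theorem strip_nil (j : Fin d) (h : Word d → ℝ) : strip j h [] = 0 := rfl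

@[simp] theorem strip_cons (j a : Fin d) (h : Word d → ℝ) (z : Word d) :
    strip j h (a :: z) = if a = j then h z else 0 := rfl

section Shuffle

variable {α : Type*}

@[simp] theorem shSum_nil_left (g : List α → ℝ) (v : List α) : shSum g [] v = g v := by
  simp [shSum, shuffle]

@[simp] theorem shSum_nil_right (g : List α → ℝ) (u : List α) : shSum g u [] = g u := by
  cases u <;> simp [shSum, shuffle]

theorem shSum_cons_cons (g : List α → ℝ) (a b : α) (u v : List α) :
    shSum g (a :: u) (b :: v) =
      shSum (fun w => g (a :: w)) u (b :: v) + shSum (fun w => g (b :: w)) (a :: u) v := by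
  simp [shSum, shuffle, List.map_map, Function.comp_def]

theorem shSum_add (g h : List α → ℝ) (u v : List α) :
    shSum (fun w => g w + h w) u v = shSum g u v + shSum h u v := by
  simp [shSum, List.sum_map_add]

theorem shSum_mul_left (c : ℝ) (g : List α → ℝ) (u v : List α) :
    shSum (fun w => c * g w) u v = c * shSum g u v := by
  simp [shSum, List.sum_map_mul_left]

@[simp] theorem shSum_zero (u v : List α) : shSum (fun _ => (0 : ℝ)) u v = 0 := by
  simp [shSum]

theorem length_of_mem_shuffle : ∀ {u v w : List α}, w ∈ shuffle u v →
    w.length = u.length + v.length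
  | [], v, w, h => by
    simp only [shuffle, List.mem_singleton] at h
    simp [h]
  | a :: u, [], w, h => by
    simp only [shuffle, List.mem_singleton] at h
    simp [h]
  | a :: u, b :: v, w, h => by
    simp only [shuffle, List.mem_append, List.mem_map] at h
    rcases h with ⟨z, hz, rfl⟩ | ⟨z, hz, rfl⟩
    · simp [length_of_mem_shuffle hz]; omega
    · simp [length_of_mem_shuffle hz]; omega
termination_by u v => u.length + v.length

theorem shSum_congr {g h : List α → ℝ} {u v : List α}
    (H : ∀ w, w.length = u.length + v.length → g w = h w) : shSum g u v = shSum h u v := by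
  unfold shSum
  congr 1
  exact List.map_congr_left fun w hw => H w (length_of_mem_shuffle hw)

@[simp] theorem shSumAll_nil (g : List α → ℝ) : shSumAll g [] = g [] := by
  simp [shSumAll, shuffleAll]

theorem shSumAll_cons (g : List α → ℝ) (u : List α) (us : List (List α)) :
    shSumAll g (u :: us) = shSumAll (shSum g u) us := by
  simp only [shSumAll, shuffleAll, List.map_flatMap]
  induction shuffleAll us with
  | nil => simp
  | cons z l ih => simp [ih, shSum]

theorem shSumAll_add (g h : List α → ℝ) (us : List (List α)) :
    shSumAll (fun w => g w + h w) us = shSumAll g us + shSumAll h us := by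
  simp [shSumAll, List.sum_map_add]

theorem shSumAll_mul_left (c : ℝ) (g : List α → ℝ) (us : List (List α)) :
    shSumAll (fun w => c * g w) us = c * shSumAll g us := by
  simp [shSumAll, List.sum_map_mul_left]

@[simp] theorem shSumAll_zero (us : List (List α)) : shSumAll (fun _ => (0 : ℝ)) us = 0 := by
  simp [shSumAll]

theorem length_of_mem_shuffleAll : ∀ {us : List (List α)} {w : List α}, w ∈ shuffleAll us →
    w.length = (us.map List.length).sum
  | [], w, h => by
    simp only [shuffleAll, List.mem_singleton] at h
    simp [h]
  | u :: us, w, h => by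
    simp only [shuffleAll, List.mem_flatMap] at h
    obtain ⟨z, hz, hw⟩ := h
    simp [length_of_mem_shuffle hw, length_of_mem_shuffleAll hz]

theorem shSumAll_congr {g h : List α → ℝ} {us : List (List α)}
    (H : ∀ w, w.length = (us.map List.length).sum → g w = h w) :
    shSumAll g us = shSumAll h us := by
  unfold shSumAll
  congr 1
  exact List.map_congr_left fun w hw => H w (length_of_mem_shuffleAll hw)

end Shuffle

/-- The first letter of a shuffled word comes from one of the two factors, so removing an initial j
is a derivation of the shuffle product. -/
theorem shSum_strip (j : Fin d) (h : Word d → ℝ) (u v : Word d) :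
    shSum (strip j h) u v =
      strip j (fun t => shSum h t v) u + strip j (fun t => shSum h u t) v := by
  rcases u with _ | ⟨a, u⟩ <;> rcases v with _ | ⟨b, v⟩
  · simp
  · simp
  · simp
  · rw [shSum_cons_cons]
    congr 1
    · by_cases hj : a = j <;> simp [hj]
    · by_cases hj : b = j <;> simp [hj]

theorem shSumAll_strip (j : Fin d) : ∀ {k : ℕ} (h : Word d → ℝ) (u : Fin k → Word d),
    shSumAll (strip j h) (List.ofFn u) =
      ∑ l, strip j (fun t => shSumAll h (List.ofFn (Function.update u l t))) (u l)
  | 0, h, u => by simp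
  | k + 1, h, u => by
    rw [List.ofFn_succ, shSumAll_cons, Fin.sum_univ_succ]
    have e : shSum (strip j h) (u 0) = fun v =>
        strip j (fun t => shSum h t v) (u 0) + strip j (fun t => shSum h (u 0) t) v :=
      funext fun v => shSum_strip j h (u 0) v
    rw [e, shSumAll_add]
    congr 1
    · rcases u 0 with _ | ⟨a, z⟩
      · simp
      · by_cases ha : a = j
        · simp [ha, List.ofFn_succ, shSumAll_cons]
        · simp [ha]
    · rw [shSumAll_strip j (fun t => shSum h (u 0) t) fun i => u i.succ]
      refine Finset.sum_congr rfl fun l _ => ?_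
      congr 1
      funext t
      rw [List.ofFn_succ, shSumAll_cons]
      have e1 : Function.update u l.succ t 0 = u 0 :=
        Function.update_of_ne (Fin.succ_ne_zero l).symm _ _
      rw [e1]
      congr 2
      funext i
      by_cases hi : i = l <;> simp [Function.update, hi]

/-! ### Shuffle coefficients -/

theorem shuffleCoeff_eq_shSumAll {k : ℕ} (w : Word d) (u : Fin k → Word d) :
    (shuffleCoeff w u : ℝ) = shSumAll (fun z => if z = w then 1 else 0) (List.ofFn u) := by
  unfold shuffleCoeff shSumAll
  induction shuffleAll (List.ofFn u) with
  | nil => simp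
  | cons z l ih =>
    rw [List.count_cons, List.map_cons, List.sum_cons, ← ih]
    by_cases h : z = w <;> simp [h, add_comm]

/-- The Leibniz rule for k factors, applied to the indicator of `j :: w`: its initial j is taken
from exactly one factor. This recursion mirrors the product rule in `compLift_field`. -/
theorem shuffleCoeff_cons {k : ℕ} (j : Fin d) (w : Word d) (u : Fin k → Word d) :
    (shuffleCoeff (j :: w) u : ℝ) =
      ∑ l, strip j (fun t => (shuffleCoeff w (Function.update u l t) : ℝ)) (u l) := by
  simp only [shuffleCoeff_eq_shSumAll]
  rw [← shSumAll_strip]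
  congr 1
  funext z
  rcases z with _ | ⟨a, z⟩
  · simp
  · by_cases h : a = j <;> simp [h]

theorem shuffleCoeff_eq_zero {k : ℕ} {w : Word d} {u : Fin k → Word d}
    (h : w.length ≠ ∑ l, (u l).length) : shuffleCoeff w u = 0 := by
  unfold shuffleCoeff
  refine List.count_eq_zero.2 fun hw => h ?_
  rw [length_of_mem_shuffleAll hw, List.map_ofFn, List.sum_ofFn]
  rfl

theorem shuffleCoeff_eq_zero_of_length_lt {k : ℕ} {w : Word d} {u : Fin k → Word d} (l : Fin k)
    (h : w.length < (u l).length) : shuffleCoeff w u = 0 := by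
  refine shuffleCoeff_eq_zero fun e => ?_
  have := Finset.single_le_sum (f := fun l => (u l).length) (fun i _ => Nat.zero_le _)
    (Finset.mem_univ l)
  omega

theorem shuffleCoeff_eq_zero_of_lt {k : ℕ} {w : Word d} {u : Fin k → Word d}
    (hu : ∀ l, u l ≠ []) (h : w.length < k) : shuffleCoeff w u = 0 := by
  refine shuffleCoeff_eq_zero fun e => ?_
  have : ∑ _l : Fin k, 1 ≤ ∑ l, (u l).length :=
    Finset.sum_le_sum fun l _ => List.length_pos_iff.2 (hu l)
  simp at this
  omega

theorem shuffleCoeff_nil_nil (u : Fin 0 → Word d) : shuffleCoeff ([] : Word d) u = 1 := by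
  simp [shuffleCoeff, shuffleAll]

theorem shSum_eq_nil (u v : Word d) :
    shSum (fun z => if z = [] then 1 else 0) u v =
      (if v = [] then 1 else 0) * (if u = [] then (1 : ℝ) else 0) := by
  rcases u with _ | ⟨a, u⟩ <;> rcases v with _ | ⟨b, v⟩ <;> simp [shSum_cons_cons]

theorem shuffleCoeff_nil_insertNth {k : ℕ} (l : Fin (k + 1)) (u : Fin k → Word d) :
    shuffleCoeff ([] : Word d) (l.insertNth (α := fun _ => Word d) [] u) =
      shuffleCoeff [] u := by
  have key : ∀ {k : ℕ} (u : Fin k → Word d),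
      (shuffleCoeff ([] : Word d) u : ℝ) = ∏ i, if u i = [] then (1 : ℝ) else 0 := by
    intro k
    induction k with
    | zero => intro u; simp [shuffleCoeff_nil_nil]
    | succ k ih =>
      intro u
      rw [shuffleCoeff_eq_shSumAll, List.ofFn_succ, shSumAll_cons, Fin.prod_univ_succ,
        ← ih, shuffleCoeff_eq_shSumAll, ← shSumAll_mul_left]
      congr 1
      funext v
      rw [shSum_eq_nil, mul_comm]
  have := key (l.insertNth (α := fun _ => Word d) [] u)
  rw [Fin.prod_univ_succAbove _ l] at this
  simp only [Fin.insertNth_apply_same, Fin.insertNth_apply_succAbove, if_true, one_mul,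
    ← key u] at this
  exact_mod_cast this

theorem shuffleCoeff_insertNth_nil (w : Word d) : ∀ {k : ℕ} (l : Fin (k + 1)) (u : Fin k → Word d),
    (shuffleCoeff w (l.insertNth (α := fun _ => Word d) [] u) : ℝ) = shuffleCoeff w u := by
  induction w with
  | nil => intro k l u; rw [shuffleCoeff_nil_insertNth]
  | cons j w ih =>
    intro k l u
    rw [shuffleCoeff_cons, shuffleCoeff_cons, Fin.sum_univ_succAbove _ l]
    simp only [Fin.insertNth_apply_same, strip_nil, zero_add, Fin.insertNth_apply_succAbove]
    refine Finset.sum_congr rfl fun i _ => ?_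
    congr 1
    funext t
    rw [← Fin.insertNth_update, ih]

/-! ### Characters -/

theorem IsTruncatedCharacter.shSum_eq {N : ℕ} {g : Word d → ℝ} (hg : IsTruncatedCharacter N g)
    {u v : Word d} (h : u.length + v.length ≤ N) : shSum g u v = g u * g v := hg.mul u v h

theorem IsTruncatedCharacter.mono {M N : ℕ} {g : Word d → ℝ} (hg : IsTruncatedCharacter N g)
    (h : M ≤ N) : IsTruncatedCharacter M g := ⟨hg.one, fun u v huv => hg.mul u v (huv.trans h)⟩

theorem IsTruncatedCharacter.shSumAll_eq {N : ℕ} {g : Word d → ℝ} (hg : IsTruncatedCharacter N g) :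
    ∀ us : List (Word d), (us.map List.length).sum ≤ N → shSumAll g us = (us.map g).prod
  | [], _ => by simp [hg.one]
  | u :: us, h => by
    simp only [List.map_cons, List.sum_cons] at h
    rw [shSumAll_cons, List.map_cons, List.prod_cons, ← hg.shSumAll_eq us (by omega),
      ← shSumAll_mul_left]
    exact shSumAll_congr fun w hw => hg.shSum_eq (by omega)

theorem shSumAll_eq_sum_shuffleCoeff {k M : ℕ} (g : Word d → ℝ) (u : Fin k → Word d)
    (h : ∑ l, (u l).length ≤ M) :
    shSumAll g (List.ofFn u) = ∑ w ∈ wordsLE d M, (shuffleCoeff w u : ℝ) * g w := by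
  have hmem : ∀ z ∈ shuffleAll (List.ofFn u), z ∈ wordsLE d M := fun z hz => by
    rw [mem_wordsLE, length_of_mem_shuffleAll hz, List.map_ofFn, List.sum_ofFn]
    exact h
  unfold shSumAll shuffleCoeff
  revert hmem
  induction shuffleAll (List.ofFn u) with
  | nil => simp
  | cons z l ih =>
    intro hmem
    rw [List.map_cons, List.sum_cons, ih fun y hy => hmem y (List.mem_cons_of_mem _ hy)]
    simp only [List.count_cons, Nat.cast_add, add_mul, Finset.sum_add_distrib]
    rw [add_comm]
    congr 1
    rw [Finset.sum_eq_single z]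
    · simp
    · intro b _ hb
      simp [hb.symm]
    · intro hz
      exact absurd (hmem z List.mem_cons_self) hz

/-- A product of values of a character is a sum of values, weighted by shuffle coefficients. -/
theorem IsTruncatedCharacter.prod_eq {k N : ℕ} {g : Word d → ℝ} (hg : IsTruncatedCharacter N g)
    (u : Fin k → Word d) (h : ∑ l, (u l).length ≤ N) :
    ∏ l, g (u l) = ∑ w ∈ wordsLE d N, (shuffleCoeff w u : ℝ) * g w := by
  rw [← shSumAll_eq_sum_shuffleCoeff g u h, hg.shSumAll_eq]
  · rw [List.map_ofFn, List.prod_ofFn]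
    rfl
  · rw [List.map_ofFn, List.sum_ofFn]
    exact h

end

/-! ### The group of characters and the increments of a rough path. -/

section

variable {d : ℕ}

/-! ### Reversal of shuffles -/

/-- Shuffles are defined by recursion on first letters; the mirror recursion on last letters is what
makes reversal, hence the antipode, compatible with them. -/
theorem shSum_concat_concat {α : Type*} : ∀ (u v : List α) (g : List α → ℝ) (a b : α),
    shSum g (u ++ [a]) (v ++ [b]) =
      shSum (fun w => g (w ++ [a])) u (v ++ [b]) + shSum (fun w => g (w ++ [b])) (u ++ [a]) v
  | [], [], g, a, b => by simp [shSum_cons_cons, add_comm]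
  | c :: u, [], g, a, b => by
    have := shSum_concat_concat u [] (fun w => g (c :: w)) a b
    simp only [List.cons_append, List.nil_append, shSum_cons_cons, shSum_nil_right] at this ⊢
    rw [this]
    ring
  | [], e :: v, g, a, b => by
    have := shSum_concat_concat [] v (fun w => g (e :: w)) a b
    simp only [List.cons_append, List.nil_append, shSum_cons_cons, shSum_nil_left] at this ⊢
    rw [this]
    ring
  | c :: u, e :: v, g, a, b => by
    have h1 := shSum_concat_concat u (e :: v) (fun w => g (c :: w)) a b
    have h2 := shSum_concat_concat (c :: u) v (fun w => g (e :: w)) a b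
    simp only [List.cons_append, shSum_cons_cons] at h1 h2 ⊢
    rw [h1, h2]
    ring
termination_by u v => u.length + v.length

theorem shSum_reverse {α : Type*} : ∀ (u v : List α) (g : List α → ℝ),
    shSum (fun w => g w.reverse) u v = shSum g u.reverse v.reverse
  | [], v, g => by simp
  | a :: u, [], g => by simp
  | a :: u, b :: v, g => by
    rw [shSum_cons_cons, List.reverse_cons, List.reverse_cons, shSum_concat_concat]
    simp only [List.reverse_cons]
    rw [shSum_reverse u (b :: v) fun w => g (w ++ [a]),
      shSum_reverse (a :: u) v fun w => g (w ++ [b])]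
    simp
termination_by u v => u.length + v.length

/-! ### Convolution -/

theorem conv_nil (g h : Word d → ℝ) : conv g h [] = g [] * h [] := by simp [conv]

theorem conv_cons (g h : Word d → ℝ) (a : Fin d) (w : Word d) :
    conv g h (a :: w) = g [] * h (a :: w) + conv (fun z => g (a :: z)) h w := by
  rw [conv, List.length_cons, Finset.sum_range_succ', add_comm]
  simp [conv]

theorem conv_add_left (g g' h : Word d → ℝ) (w : Word d) :
    conv (fun z => g z + g' z) h w = conv g h w + conv g' h w := by
  simp [conv, add_mul, Finset.sum_add_distrib]

theorem conv_mul_left (c : ℝ) (g h : Word d → ℝ) (w : Word d) :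
    conv (fun z => c * g z) h w = c * conv g h w := by
  simp [conv, Finset.mul_sum, mul_assoc]

theorem conv_assoc (g₁ g₂ g₃ : Word d → ℝ) (w : Word d) :
    conv (conv g₁ g₂) g₃ w = conv g₁ (conv g₂ g₃) w := by
  induction w generalizing g₁ with
  | nil => simp [conv_nil, mul_assoc]
  | cons a w ih =>
    simp only [conv_cons, conv_nil, conv_add_left, ih]
    rw [conv_mul_left]
    ring

theorem conv_congr {g g' h h' : Word d → ℝ} {w : Word d}
    (hg : ∀ z : Word d, z.length ≤ w.length → g z = g' z)
    (hh : ∀ z : Word d, z.length ≤ w.length → h z = h' z) : conv g h w = conv g' h' w := by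
  refine Finset.sum_congr rfl fun k _ => ?_
  rw [hg _ (by simp), hh _ (by simp)]

/-- The counit, which is the unit for the convolution product. -/
def counit (w : Word d) : ℝ := if w = [] then 1 else 0

@[simp] theorem counit_nil : counit ([] : Word d) = 1 := by simp [counit]

@[simp] theorem counit_cons (a : Fin d) (w : Word d) : counit (a :: w) = 0 := by simp [counit]

theorem counit_conv (g : Word d → ℝ) (w : Word d) : conv counit g w = g w := by
  rcases w with _ | ⟨a, w⟩
  · simp [conv_nil]
  · rw [conv_cons]
    simp [conv]

/-- The bialgebra property: cutting a shuffle of u and v in two amounts to cutting u and v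
separately and shuffling the pieces. Hence characters are closed under convolution. -/
theorem shSum_conv : ∀ (u v : Word d) (g h : Word d → ℝ),
    shSum (conv g h) u v =
      ∑ i ∈ Finset.range (u.length + 1), ∑ j ∈ Finset.range (v.length + 1),
        shSum g (u.take i) (v.take j) * shSum h (u.drop i) (v.drop j)
  | [], v, g, h => by simp [conv]
  | a :: u, [], g, h => by simp [conv]
  | a :: u, b :: v, g, h => by
    rw [shSum_cons_cons]
    simp only [conv_cons]
    rw [shSum_add, shSum_add, shSum_mul_left, shSum_mul_left,
      shSum_conv u (b :: v) (fun z => g (a :: z)) h, shSum_conv (a :: u) v (fun z => g (b :: z)) h]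
    simp only [List.length_cons, Finset.sum_range_succ' _ (u.length + 1),
      Finset.sum_range_succ' _ (v.length + 1), List.take_succ_cons, List.drop_succ_cons,
      List.take_zero, List.drop_zero, shSum_nil_left, shSum_nil_right, shSum_cons_cons, add_mul,
      Finset.sum_add_distrib]
    ring
termination_by u v => u.length + v.length

theorem IsTruncatedCharacter.conv {N : ℕ} {g h : Word d → ℝ} (hg : IsTruncatedCharacter N g)
    (hh : IsTruncatedCharacter N h) : IsTruncatedCharacter N (conv g h) := by
  refine ⟨by rw [conv_nil, hg.one, hh.one, one_mul], fun u v huv => ?_⟩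
  change shSum _ u v = _
  rw [shSum_conv, RoughIto.conv, RoughIto.conv, Finset.sum_mul_sum]
  refine Finset.sum_congr rfl fun i hi => Finset.sum_congr rfl fun j hj => ?_
  rw [hg.shSum_eq, hh.shSum_eq]
  · ring
  · simp only [List.length_drop]; omega
  · simp only [List.length_take]; omega

theorem IsTruncatedCharacter.inv {N : ℕ} {g : Word d → ℝ} (hg : IsTruncatedCharacter N g) :
    IsTruncatedCharacter N (inv g) := by
  refine ⟨by simp [RoughIto.inv, hg.one], fun u v huv => ?_⟩
  change shSum _ u v = _
  have : shSum (RoughIto.inv g) u v =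
      shSum (fun w => (-1) ^ (u.length + v.length) * g w.reverse) u v :=
    shSum_congr fun w hw => by rw [RoughIto.inv, hw]
  rw [this, shSum_mul_left, shSum_reverse, hg.shSum_eq (by simpa using huv), RoughIto.inv,
    RoughIto.inv, pow_add]
  ring

theorem inv_inv (g : Word d → ℝ) : inv (inv g) = g := by
  funext w
  simp [inv, ← mul_assoc, ← mul_pow]

/-- The antipode identity as a telescoping sum. The words of the k-th shuffle split by which factor
gives their first letter; those led by the right factor cancel against those of the next term led by
the left one. -/
theorem sum_shSum_reverse_take (g : Word d → ℝ) (w : Word d) : ∀ (b : Fin d) (p : Word d),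
    ∑ k ∈ Finset.range (w.length + 1),
      (-1) ^ k * shSum g ((w.take k).reverse ++ b :: p) (w.drop k) =
      shSum (fun z => g (b :: z)) p w := by
  induction w with
  | nil => intro b p; simp
  | cons a w ih =>
    intro b p
    rw [List.length_cons, Finset.sum_range_succ']
    have := ih a (b :: p)
    simp only [List.take_succ_cons, List.reverse_cons, List.append_assoc, List.drop_succ_cons,
      List.singleton_append, List.take_zero, List.drop_zero, List.reverse_nil, List.nil_append,
      pow_zero, one_mul, pow_succ, mul_neg, mul_one, neg_mul, Finset.sum_neg_distrib] at this ⊢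
    rw [this, shSum_cons_cons]
    ring

theorem IsTruncatedCharacter.inv_conv {N : ℕ} {g : Word d → ℝ} (hg : IsTruncatedCharacter N g)
    {w : Word d} (hw : w.length ≤ N) : RoughIto.conv (RoughIto.inv g) g w = counit w := by
  have e : RoughIto.conv (RoughIto.inv g) g w = ∑ k ∈ Finset.range (w.length + 1),
      (-1) ^ k * shSum g (w.take k).reverse (w.drop k) := by
    refine Finset.sum_congr rfl fun k hk => ?_
    have hk' : k ≤ w.length := by simpa [Nat.lt_succ_iff] using hk
    rw [RoughIto.inv, List.length_take, min_eq_left hk', hg.shSum_eq, mul_assoc]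
    simp only [List.length_reverse, List.length_take, List.length_drop]
    omega
  rw [e]
  rcases w with _ | ⟨a, w⟩
  · simp [hg.one]
  · rw [List.length_cons, Finset.sum_range_succ']
    have := sum_shSum_reverse_take g w a []
    simp only [List.take_succ_cons, List.reverse_cons, List.drop_succ_cons, List.take_zero,
      List.drop_zero, List.reverse_nil, pow_zero, one_mul, pow_succ, mul_neg, mul_one, neg_mul,
      Finset.sum_neg_distrib, shSum_nil_left, counit_cons] at this ⊢
    rw [this]
    ring

theorem IsTruncatedCharacter.conv_inv {N : ℕ} {g : Word d → ℝ} (hg : IsTruncatedCharacter N g)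
    {w : Word d} (hw : w.length ≤ N) : RoughIto.conv g (RoughIto.inv g) w = counit w := by
  have := hg.inv.inv_conv hw
  rwa [inv_inv] at this

/-- Summing over pairs of words of total length at most `K` is summing over the words of length at
most `K` and their deconcatenations. -/
theorem sum_wordsLE_append {M : Type*} [AddCommMonoid M] (K : ℕ) (H : Word d → Word d → M) :
    ∑ b ∈ wordsLE d K, ∑ a ∈ wordsLE d (K - b.length), H a b =
      ∑ z ∈ wordsLE d K, ∑ k ∈ Finset.range (z.length + 1), H (z.take k) (z.drop k) := by
  rw [Finset.sum_sigma', Finset.sum_sigma']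
  refine Finset.sum_bij' (fun p _ => ⟨p.2 ++ p.1, p.2.length⟩)
    (fun q _ => ⟨q.1.drop q.2, q.1.take q.2⟩) ?_ ?_ ?_ ?_ ?_
  · rintro ⟨b, a⟩ h
    simp only [Finset.mem_sigma, mem_wordsLE, Finset.mem_range, List.length_append] at h ⊢
    omega
  · rintro ⟨z, k⟩ h
    simp only [Finset.mem_sigma, mem_wordsLE, Finset.mem_range, List.length_drop,
      List.length_take] at h ⊢
    omega
  · rintro ⟨b, a⟩ h
    simp
  · rintro ⟨z, k⟩ h
    simp only [Finset.mem_sigma, mem_wordsLE, Finset.mem_range] at h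
    simp only [List.take_append_drop, List.length_take]
    rw [min_eq_left (by omega)]
  · rintro ⟨b, a⟩ h
    simp

/-! ### Increments of rough paths -/

section Incr

variable {γ T : ℝ} {W : ℝ → Word d → ℝ}

theorem IsGeometricRoughPath.incr_character (hW : IsGeometricRoughPath γ T W) {s t : ℝ}
    (hs : s ∈ Icc 0 T) (ht : t ∈ Icc 0 T) : IsTruncatedCharacter (level γ) (incr W s t) :=
  (hW.character s hs).inv.conv (hW.character t ht)

theorem IsGeometricRoughPath.incr_self (hW : IsGeometricRoughPath γ T W) {s : ℝ}
    (hs : s ∈ Icc 0 T) {w : Word d} (hw : w.length ≤ level γ) : incr W s s w = counit w :=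
  (hW.character s hs).inv_conv hw

/-- Chen's relation. -/
theorem IsGeometricRoughPath.conv_incr (hW : IsGeometricRoughPath γ T W) {s u t : ℝ}
    (hu : u ∈ Icc 0 T) {w : Word d} (hw : w.length ≤ level γ) :
    conv (incr W s u) (incr W u t) w = incr W s t w := by
  unfold incr
  rw [conv_assoc]
  refine conv_congr (fun _ _ => rfl) fun z hz => ?_
  rw [← conv_assoc, ← counit_conv (W t) z]
  exact conv_congr (fun y hy => (hW.character u hu).conv_inv (by omega)) fun _ _ => rfl

/-- The homogeneous norm takes the |w|-th root of the coordinate at w, so a Hölder bound on the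
distance gives order |w| for that coordinate. -/
theorem IsGeometricRoughPath.incr_bound (hW : IsGeometricRoughPath γ T W) {w : Word d}
    (hw : w.length ≤ level γ) : ∃ C : ℝ, ∀ s ∈ Icc 0 T, ∀ t ∈ Icc 0 T,
      |incr W s t w| ≤ C * (|t - s| ^ γ) ^ w.length := by
  rcases eq_or_ne w [] with rfl | hne
  · refine ⟨1, fun s hs t ht => ?_⟩
    simp [(hW.incr_character hs ht).one]
  obtain ⟨C, hC⟩ := hW.holder
  refine ⟨C ^ w.length, fun s hs t ht => ?_⟩
  have hlen : 0 < w.length := List.length_pos_iff.2 hne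
  have h1 : ((Nat.factorial w.length : ℝ≥0) * ‖incr W s t w‖₊) ^ (1 / (w.length : ℝ)) ≤
      homDist (level γ) (W t) (W s) :=
    Finset.le_sup (s := (wordsLE d (level γ)).filter fun w => w ≠ [])
      (f := fun w => ((Nat.factorial w.length : ℝ≥0) * ‖incr W s t w‖₊) ^ (1 / (w.length : ℝ)))
      (by simp [mem_wordsLE, hw, hne])
  have h2 : (Nat.factorial w.length : ℝ≥0) * ‖incr W s t w‖₊ ≤
      homDist (level γ) (W t) (W s) ^ w.length := by
    have := pow_le_pow_left₀ zero_le h1 w.length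
    rwa [← NNReal.rpow_natCast, ← NNReal.rpow_mul, one_div,
      inv_mul_cancel₀ (by positivity), NNReal.rpow_one] at this
  have h3 : ‖incr W s t w‖₊ ≤ homDist (level γ) (W t) (W s) ^ w.length := by
    refine le_trans ?_ h2
    have : (1 : ℝ≥0) ≤ (Nat.factorial w.length : ℝ≥0) := by
      exact_mod_cast Nat.factorial_pos _
    exact le_mul_of_one_le_left zero_le this
  have h4 : |incr W s t w| ≤ (homDist (level γ) (W t) (W s) : ℝ) ^ w.length := by
    exact_mod_cast h3
  rw [← mul_pow]
  exact h4.trans (pow_le_pow_left₀ (NNReal.coe_nonneg _) (hC s hs t ht) _)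

end Incr

end

/-! ### Symmetric derivatives and the combinatorics of composition. -/

section

variable {d : ℕ} {E F : Type*} [NormedAddCommGroup E] [NormedSpace ℝ E]
  [NormedAddCommGroup F] [NormedSpace ℝ F]

/-! ### Symmetry of iterated derivatives -/

theorem iteratedFDeriv_cons_cons_comm {k : ℕ} {φ : E → F} (hφ : ContDiff ℝ (k + 2 : ℕ) φ)
    (x a b : E) (v : Fin k → E) :
    iteratedFDeriv ℝ (k + 2) φ x (Fin.cons a (Fin.cons b v : Fin (k + 1) → E)) =
      iteratedFDeriv ℝ (k + 2) φ x (Fin.cons b (Fin.cons a v : Fin (k + 1) → E)) := by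
  have hC2 : ContDiff ℝ 2 (iteratedFDeriv ℝ k φ) :=
    hφ.iteratedFDeriv_right (by norm_cast; omega)
  have hd : Differentiable ℝ (fderiv ℝ (iteratedFDeriv ℝ k φ)) :=
    (hC2.fderiv_right (m := 1) (by norm_num)).differentiable (by norm_num)
  have key : ∀ a b : E, iteratedFDeriv ℝ (k + 2) φ x (Fin.cons a (Fin.cons b v : Fin (k + 1) → E)) =
      fderiv ℝ (fderiv ℝ (iteratedFDeriv ℝ k φ)) x a b v := by
    intro a b
    have hd1 : DifferentiableAt ℝ (iteratedFDeriv ℝ (k + 1) φ) x :=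
      hφ.contDiffAt.differentiableAt_iteratedFDeriv (by norm_cast; omega)
    rw [hd1.iteratedFDeriv_succ_apply_left', Fin.cons_zero, Fin.tail_cons]
    have e : (fun y => iteratedFDeriv ℝ (k + 1) φ y (Fin.cons b v)) =
        fun y => fderiv ℝ (iteratedFDeriv ℝ k φ) y b v := by
      funext y
      rw [iteratedFDeriv_succ_apply_left, Fin.cons_zero, Fin.tail_cons]
    rw [e]
    have h1 := ((hd x).hasFDerivAt.clm_apply
      (hasFDerivAt_const b x)).continuousMultilinear_apply_const v
    rw [h1.fderiv]
    simp
  rw [key, key]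
  have := (hC2.contDiffAt (x := x)).isSymmSndFDerivAt (by simp)
  rw [this a b]

/-- An argument is moved to the front by adjacent swaps; the swap of the first two slots is the
symmetry of the second derivative of D^k φ. -/
theorem iteratedFDeriv_insertNth {k : ℕ} {φ : E → F} (hφ : ContDiff ℝ (k + 1 : ℕ) φ)
    (l : Fin (k + 1)) (x a : E) (v : Fin k → E) :
    iteratedFDeriv ℝ (k + 1) φ x (l.insertNth (α := fun _ => E) a v) =
      iteratedFDeriv ℝ (k + 1) φ x (Fin.cons a v : Fin (k + 1) → E) := by
  induction k generalizing x with
  | zero =>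
    obtain rfl : l = 0 := Fin.fin_one_eq_zero l
    rw [Fin.insertNth_zero']
  | succ k ih =>
    refine Fin.cases ?_ (fun l => ?_) l
    · rw [Fin.insertNth_zero']
    · have hv : v = Fin.cons (v 0) (Fin.tail v) := (Fin.cons_self_tail v).symm
      rw [hv, Fin.insertNth_succ_cons, ← iteratedFDeriv_cons_cons_comm hφ]
      have hd1 : DifferentiableAt ℝ (iteratedFDeriv ℝ (k + 1) φ) x :=
        hφ.contDiffAt.differentiableAt_iteratedFDeriv (by norm_cast; omega)
      rw [hd1.iteratedFDeriv_succ_apply_left', hd1.iteratedFDeriv_succ_apply_left']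
      simp only [Fin.cons_zero, Fin.tail_cons]
      congr 2
      funext y
      exact ih (hφ.of_le (by norm_cast; omega)) l y _

/-! ### Smoothness of iterated vector fields -/

section Smooth

variable {f : Fin d → E → E} {r : ℕ}

theorem gammaWord_append (f : Fin d → E → E) (v w : Word d) (φ : E → F) :
    gammaWord f (v ++ w) φ = gammaWord f v (gammaWord f w φ) := by
  induction v with
  | nil => rfl
  | cons i v ih => simp only [List.cons_append, gammaWord, ih]

theorem field_eq_gammaWord (f : Fin d → E → E) (w : Word d) : field f w = gammaWord f w id := by
  induction w with
  | nil => rfl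
  | cons i w ih =>
    simp only [field, gammaWord, ih]
    rfl

theorem field_concat (f : Fin d → E → E) (w : Word d) (i : Fin d) :
    field f (w ++ [i]) = gammaWord f w (f i) := by
  rw [field_eq_gammaWord, gammaWord_append]
  congr 1
  funext x
  simp [gammaWord, gamma]

/-- The bound is r + 1 and not r because the innermost field is differentiated only |w| - 1 times,
while φ is differentiated |w| times. -/
theorem contDiff_gammaWord (hf : ∀ i, ContDiff ℝ r (f i)) {φ : E → F} (w : Word d) (k : ℕ)
    (hφ : ContDiff ℝ (k + w.length : ℕ) φ) (hk : k + w.length ≤ r + 1) :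
    ContDiff ℝ k (gammaWord f w φ) := by
  induction w generalizing k with
  | nil => simpa [gammaWord] using hφ
  | cons i w ih =>
    simp only [List.length_cons] at hφ hk
    have h := ih (k + 1) (hφ.of_le (by norm_cast; omega)) (by omega)
    exact (h.fderiv_right (m := k) (by norm_cast)).clm_apply ((hf i).of_le (by norm_cast; omega))

theorem contDiff_field (hf : ∀ i, ContDiff ℝ r (f i)) (w : Word d) (k : ℕ)
    (hk : k + w.length ≤ r + 1) : ContDiff ℝ k (field f w) := by
  rw [field_eq_gammaWord]
  exact contDiff_gammaWord hf w k contDiff_id hk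

end Smooth

/-! ### The composition of a controlled path with a function -/

/-- The non-empty words of length at most `M`. -/
def nonemptyWords (d M : ℕ) : Finset (Word d) := (wordsLE d M).filter fun v => v ≠ []

theorem mem_nonemptyWords {M : ℕ} {v : Word d} :
    v ∈ nonemptyWords d M ↔ v.length ≤ M ∧ v ≠ [] := by
  simp [nonemptyWords, mem_wordsLE]

theorem sum_wordsLE_eq_add {M : Type*} [AddCommMonoid M] (K : ℕ) (H : Word d → M) :
    ∑ v ∈ wordsLE d K, H v = H [] + ∑ v ∈ nonemptyWords d K, H v := by
  have : wordsLE d K = insert [] (nonemptyWords d K) := by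
    ext v
    by_cases h : v = [] <;> simp [mem_wordsLE, mem_nonemptyWords, h]
  rw [this, Finset.sum_insert (by simp [mem_nonemptyWords])]

theorem sum_pi_nonemptyWords_eq {k : ℕ} {w : Word d} {m M : ℕ} (hm : w.length ≤ m) (hM : m ≤ M)
    (H : (Fin k → Word d) → F) :
    ∑ u ∈ Fintype.piFinset (fun _ : Fin k => nonemptyWords d m), (shuffleCoeff w u : ℝ) • H u =
      ∑ u ∈ Fintype.piFinset (fun _ : Fin k => nonemptyWords d M),
        (shuffleCoeff w u : ℝ) • H u := by
  refine Finset.sum_subset ?_ ?_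
  · refine Fintype.piFinset_subset _ _ fun _ v hv => ?_
    rw [mem_nonemptyWords] at hv ⊢
    exact ⟨hv.1.trans hM, hv.2⟩
  · intro u hu hu'
    simp only [Fintype.mem_piFinset, mem_nonemptyWords, not_forall] at hu hu'
    obtain ⟨l, hl⟩ := hu'
    have : ¬ (u l).length ≤ m := fun h => hl ⟨h, (hu l).2⟩
    rw [shuffleCoeff_eq_zero_of_length_lt l (by omega)]
    simp

/-- A form with index sets independent of w, so that sums over different w can be exchanged. The
added terms, including k = 0 for non-empty w, have zero shuffle coefficient because shuffling
preserves total length. -/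
theorem compLift_eq (φ : E → F) (y : Word d → E) {w : Word d} {M : ℕ} (hM : w.length ≤ M) :
    compLift φ y w = ∑ k ∈ Finset.range (M + 1), ((Nat.factorial k : ℝ)⁻¹) •
      ∑ u ∈ Fintype.piFinset (fun _ : Fin k => nonemptyWords d M),
        (shuffleCoeff w u : ℝ) • iteratedFDeriv ℝ k φ (y []) (fun j => y (u j)) := by
  have hvan : ∀ k : ℕ, w.length < k → ((Nat.factorial k : ℝ)⁻¹) •
      ∑ u ∈ Fintype.piFinset (fun _ : Fin k => nonemptyWords d M),
        (shuffleCoeff w u : ℝ) • iteratedFDeriv ℝ k φ (y []) (fun j => y (u j)) = 0 := by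
    intro k hk
    rw [Finset.sum_eq_zero, smul_zero]
    intro u hu
    simp only [Fintype.mem_piFinset, mem_nonemptyWords] at hu
    rw [shuffleCoeff_eq_zero_of_lt (fun l => (hu l).2) hk]
    simp
  by_cases hw : w = []
  · subst hw
    rw [Finset.sum_range_succ', Finset.sum_eq_zero fun k _ => hvan (k + 1) (by simp)]
    simp [compLift, shuffleCoeff_nil_nil]
  · rw [compLift, if_neg hw]
    have e : ∀ k, ∑ u ∈ Fintype.piFinset
          (fun _ : Fin k => (wordsLE d w.length).filter fun v => v ≠ []),
        (shuffleCoeff w u : ℝ) • iteratedFDeriv ℝ k φ (y []) (fun j => y (u j)) =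
        ∑ u ∈ Fintype.piFinset (fun _ : Fin k => nonemptyWords d M),
        (shuffleCoeff w u : ℝ) • iteratedFDeriv ℝ k φ (y []) (fun j => y (u j)) :=
      fun k => sum_pi_nonemptyWords_eq le_rfl hM _
    simp only [e]
    refine Finset.sum_subset ?_ ?_
    · intro k hk
      simp only [Finset.mem_Icc, Finset.mem_range] at hk ⊢
      omega
    · intro k hk hk'
      simp only [Finset.mem_Icc, Finset.mem_range, not_and, not_le] at hk hk'
      rcases Nat.eq_zero_or_pos k with rfl | h
      · rw [Finset.sum_eq_zero, smul_zero]
        intro u _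
        rw [shuffleCoeff_eq_zero (by simpa using hw)]
        simp
      · exact hvan k (hk' h)

theorem compLift_congr (φ : E → F) {y z : Word d → E} {w : Word d}
    (h : ∀ v : Word d, v.length ≤ w.length → y v = z v) : compLift φ y w = compLift φ z w := by
  rw [compLift_eq φ y le_rfl, compLift_eq φ z le_rfl]
  refine Finset.sum_congr rfl fun k _ => ?_
  congr 1
  refine Finset.sum_congr rfl fun u hu => ?_
  simp only [Fintype.mem_piFinset, mem_nonemptyWords] at hu
  rw [h [] (by simp)]
  congr 2
  funext l
  exact h _ (hu l).1

/-- Only tuples whose l-th word starts with j contribute, and they are parametrised by the tail t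
and the other words. Those words may be restricted to length at most |w|, longer ones having
coefficient zero. -/
theorem sum_strip_shuffleCoeff {k : ℕ} (j : Fin d) (w : Word d) (l : Fin (k + 1))
    (H : (Fin (k + 1) → Word d) → F) :
    ∑ u ∈ Fintype.piFinset (fun _ : Fin (k + 1) => nonemptyWords d (w.length + 1)),
        strip j (fun t => (shuffleCoeff w (Function.update u l t) : ℝ)) (u l) • H u =
      ∑ t ∈ wordsLE d w.length,
        ∑ u ∈ Fintype.piFinset (fun _ : Fin k => nonemptyWords d w.length),
          (shuffleCoeff w (l.insertNth (α := fun _ => Word d) t u) : ℝ) •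
            H (l.insertNth (α := fun _ => Word d) (j :: t) u) := by
  rw [← Finset.sum_product']
  set e : Word d × (Fin k → Word d) → (Fin (k + 1) → Word d) :=
    fun p => l.insertNth (α := fun _ => Word d) (j :: p.1) p.2 with he
  set P := wordsLE d w.length ×ˢ Fintype.piFinset (fun _ : Fin k => nonemptyWords d w.length)
    with hP
  have hinj : Function.Injective e := by
    rintro ⟨t, u⟩ ⟨t', u'⟩ h
    obtain ⟨h1, h2⟩ := Fin.insertNth_inj.1 h
    simp only [List.cons.injEq, true_and] at h1
    exact Prod.ext h1 h2
  have e1 : ∀ p ∈ P, (shuffleCoeff w (l.insertNth (α := fun _ => Word d) p.1 p.2) : ℝ) •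
        H (l.insertNth (α := fun _ => Word d) (j :: p.1) p.2) =
      strip j (fun t => (shuffleCoeff w (Function.update (e p) l t) : ℝ)) (e p l) • H (e p) := by
    intro p _
    simp [he]
  rw [Finset.sum_congr rfl e1, ← Finset.sum_image (s := P) (g := e) (f := fun u =>
    strip j (fun t => (shuffleCoeff w (Function.update u l t) : ℝ)) (u l) • H u) hinj.injOn]
  refine (Finset.sum_subset ?_ ?_).symm
  · intro u hu
    obtain ⟨⟨t, u⟩, hp, rfl⟩ := Finset.mem_image.1 hu
    simp only [hP, Finset.mem_product, mem_wordsLE, Fintype.mem_piFinset, mem_nonemptyWords] at hp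
    rw [Fintype.mem_piFinset, Fin.forall_iff_succAbove l]
    simp only [he, Fin.insertNth_apply_same, Fin.insertNth_apply_succAbove, mem_nonemptyWords,
      List.length_cons]
    exact ⟨⟨by omega, by simp⟩, fun i => ⟨by have := (hp.2 i).1; omega, (hp.2 i).2⟩⟩
  · intro u hu hu'
    rw [Fintype.mem_piFinset] at hu
    simp only [mem_nonemptyWords] at hu
    rcases hul : u l with _ | ⟨a, t⟩
    · simp
    by_cases ha : a = j
    · subst ha
      suffices hc : shuffleCoeff w (Function.update u l t) = 0 by simp [hc]
      have ht : t.length ≤ w.length := by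
        have := (hu l).1
        rw [hul, List.length_cons] at this
        omega
      have : ∃ i, w.length < (u (l.succAbove i)).length := by
        by_contra! hcon
        refine hu' (Finset.mem_image.2 ⟨(t, l.removeNth u), ?_, ?_⟩)
        · simp only [hP, Finset.mem_product, mem_wordsLE, Fintype.mem_piFinset, mem_nonemptyWords]
          exact ⟨ht, fun i => ⟨hcon i, (hu _).2⟩⟩
        · simp only [he]
          rw [← hul]
          exact Fin.insertNth_self_removeNth _ _
      obtain ⟨i, hi⟩ := this
      refine shuffleCoeff_eq_zero_of_length_lt (l.succAbove i) ?_
      rwa [Function.update_of_ne (Fin.succAbove_ne _ _)]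
    · simp [ha]

/-- The recursion of shuffle coefficients on the first letter, as a summation formula for
symmetric functions. -/
theorem sum_shuffleCoeff_cons {V : Type*} {k : ℕ} (j : Fin d) (w : Word d) (y : Word d → V)
    (Φ : (Fin (k + 1) → V) → F)
    (hΦ : ∀ l a v, Φ (Fin.insertNth (α := fun _ => V) l a v) = Φ (Fin.cons a v)) :
    ∑ u ∈ Fintype.piFinset (fun _ : Fin (k + 1) => nonemptyWords d (w.length + 1)),
        (shuffleCoeff (j :: w) u : ℝ) • Φ (fun i => y (u i)) =
      ((k + 1 : ℕ) : ℝ) • ∑ u ∈ Fintype.piFinset (fun _ : Fin k => nonemptyWords d w.length),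
        (shuffleCoeff w u : ℝ) • Φ (Fin.cons (y [j]) fun i => y (u i)) +
      ∑ u ∈ Fintype.piFinset (fun _ : Fin (k + 1) => nonemptyWords d w.length),
        (shuffleCoeff w u : ℝ) •
          ∑ l, Φ (Function.update (fun i => y (u i)) l (y (j :: u l))) := by
  simp only [shuffleCoeff_cons, Finset.sum_smul, Finset.smul_sum (s := Finset.univ)]
  rw [Finset.sum_comm, Finset.sum_comm (t := Finset.univ)]
  have key : ∀ l : Fin (k + 1),
      ∑ u ∈ Fintype.piFinset (fun _ : Fin (k + 1) => nonemptyWords d (w.length + 1)),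
        strip j (fun t => (shuffleCoeff w (Function.update u l t) : ℝ)) (u l) •
          Φ (fun i => y (u i)) =
      ∑ u ∈ Fintype.piFinset (fun _ : Fin k => nonemptyWords d w.length),
        (shuffleCoeff w u : ℝ) • Φ (Fin.cons (y [j]) fun i => y (u i)) +
      ∑ u ∈ Fintype.piFinset (fun _ : Fin (k + 1) => nonemptyWords d w.length),
        (shuffleCoeff w u : ℝ) • Φ (Function.update (fun i => y (u i)) l (y (j :: u l))) := by
    intro l
    rw [sum_strip_shuffleCoeff j w l fun u => Φ fun i => y (u i), sum_wordsLE_eq_add]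
    have hins : ∀ (t : Word d) (u : Fin k → Word d),
        (fun i => y (l.insertNth (α := fun _ => Word d) t u i)) =
          l.insertNth (α := fun _ => V) (y t) fun i => y (u i) := by
      intro t u
      refine (Fin.insertNth_eq_iff.2 ⟨?_, ?_⟩).symm
      · simp
      · funext i; simp [Fin.removeNth]
    -- If the tail is empty, the l-th word was `[j]` alone: the slot drops out of the coefficient
    -- and symmetry moves its value to the front. Otherwise j is prepended to a non-empty word.
    congr 1
    · refine Finset.sum_congr rfl fun u _ => ?_
      rw [shuffleCoeff_insertNth_nil, hins, hΦ]
    · rw [← Finset.sum_product']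
      refine Finset.sum_bij' (fun p _ => l.insertNth (α := fun _ => Word d) p.1 p.2)
        (fun u _ => (u l, l.removeNth u)) ?_ ?_ ?_ ?_ ?_
      · rintro ⟨t, u⟩ h
        rw [Finset.mem_product, Fintype.mem_piFinset] at h
        rw [Fintype.mem_piFinset, Fin.forall_iff_succAbove l]
        simpa using h
      · intro u h
        rw [Fintype.mem_piFinset] at h
        rw [Finset.mem_product, Fintype.mem_piFinset]
        exact ⟨h l, fun i => h _⟩
      · rintro ⟨t, u⟩ _
        simp
      · intro u _
        simp
      · rintro ⟨t, u⟩ _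
        simp only [Fin.insertNth_apply_same]
        rw [hins, hins, Fin.update_insertNth]
  rw [Finset.sum_congr rfl fun l _ => key l, Finset.sum_add_distrib, Finset.sum_const,
    Finset.card_univ, Fintype.card_fin, Nat.cast_smul_eq_nsmul]

end

/-! ### The Faà di Bruno formula for iterated vector fields. -/

section

variable {d : ℕ} {E F : Type*} [NormedAddCommGroup E] [NormedSpace ℝ E]
  [NormedAddCommGroup F] [NormedSpace ℝ F]

/-- The derivative in direction `f_j` of a term of the composition of the fields with `φ`. -/
theorem hasFDerivAt_iteratedFDeriv_field {f : Fin d → E → E} {r k m : ℕ}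
    (hf : ∀ i, ContDiff ℝ r (f i)) (hm : m ≤ r) {φ : E → F} (hφ : ContDiff ℝ (k + 1 : ℕ) φ)
    (u : Fin k → Word d) (hu : ∀ l, (u l).length ≤ m) (x : E) :
    ∃ L : E →L[ℝ] F,
      HasFDerivAt (fun x => iteratedFDeriv ℝ k φ x fun l => field f (u l) x) L x ∧
      ∀ j, L (f j x) =
        iteratedFDeriv ℝ (k + 1) φ x
          (Fin.cons (field f [j] x) (fun l => field f (u l) x) : Fin (k + 1) → E) +
        ∑ l, iteratedFDeriv ℝ k φ x
          (Function.update (fun l => field f (u l) x) l (field f (j :: u l) x)) := by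
  have hd : DifferentiableAt ℝ (iteratedFDeriv ℝ k φ) x :=
    hφ.contDiffAt.differentiableAt_iteratedFDeriv (by norm_cast; omega)
  have hg : ∀ l, HasFDerivAt (field f (u l)) (fderiv ℝ (field f (u l)) x) x := fun l =>
    ((contDiff_field hf (u l) 1 (by have := hu l; omega)).differentiable (by simp) x).hasFDerivAt
  refine ⟨_, hd.hasFDerivAt.continuousMultilinearMap_apply hg, fun j => ?_⟩
  rw [iteratedFDeriv_succ_apply_left]
  simp [field]

/-- The composition of the coordinates `F_v(x)` with `φ` has the coordinates `Γ_w φ(x)`. -/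
theorem compLift_field {f : Fin d → E → E} {r : ℕ} (hf : ∀ i, ContDiff ℝ r (f i))
    {φ : E → F} (w : Word d) (hφ : ContDiff ℝ w.length φ) (hw : w.length ≤ r + 1) (x : E) :
    compLift φ (fun v => field f v x) w = gammaWord f w φ x := by
  induction w generalizing x with
  | nil => simp [compLift, gammaWord, field]
  | cons j w ih =>
    simp only [List.length_cons] at hφ hw
    have ih' : gammaWord f w φ = fun x => ∑ k ∈ Finset.range (w.length + 1),
        ((Nat.factorial k : ℝ)⁻¹) •
          ∑ u ∈ Fintype.piFinset (fun _ : Fin k => nonemptyWords d w.length),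
            (shuffleCoeff w u : ℝ) • iteratedFDeriv ℝ k φ x (fun l => field f (u l) x) := by
      funext x
      rw [← ih (hφ.of_le (by norm_cast; omega)) (by omega) x, compLift_eq _ _ le_rfl]
      rfl
    -- `A k` collects the terms where the derivative in direction f_j hits D^k φ, `B k` those where
    -- it hits one of the fields F_{u_l}.
    set A : ℕ → F := fun k => ∑ u ∈ Fintype.piFinset (fun _ : Fin k => nonemptyWords d w.length),
      (shuffleCoeff w u : ℝ) • iteratedFDeriv ℝ (k + 1) φ x
        (Fin.cons (field f [j] x) (fun l => field f (u l) x) : Fin (k + 1) → E) with hA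
    set B : ℕ → F := fun k => ∑ u ∈ Fintype.piFinset (fun _ : Fin k => nonemptyWords d w.length),
      (shuffleCoeff w u : ℝ) • ∑ l, iteratedFDeriv ℝ k φ x
          (Function.update (fun l => field f (u l) x) l (field f (j :: u l) x)) with hB
    have hL : gammaWord f (j :: w) φ x =
        ∑ k ∈ Finset.range (w.length + 1), ((Nat.factorial k : ℝ)⁻¹) • (A k + B k) := by
      have hder : ∀ k ∈ Finset.range (w.length + 1), ∃ L : E →L[ℝ] F,
          HasFDerivAt (fun x => ((Nat.factorial k : ℝ)⁻¹) •
          ∑ u ∈ Fintype.piFinset (fun _ : Fin k => nonemptyWords d w.length),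
            (shuffleCoeff w u : ℝ) • iteratedFDeriv ℝ k φ x (fun l => field f (u l) x)) L x ∧
          L (f j x) = ((Nat.factorial k : ℝ)⁻¹) • (A k + B k) := by
        intro k hk
        rw [Finset.mem_range] at hk
        have hu : ∀ u ∈ Fintype.piFinset (fun _ : Fin k => nonemptyWords d w.length),
            ∀ l, (u l).length ≤ w.length := fun u hu l =>
          (mem_nonemptyWords.1 (Fintype.mem_piFinset.1 hu l)).1
        have := fun u hu' => hasFDerivAt_iteratedFDeriv_field (k := k) hf (by omega : w.length ≤ r)
          (hφ.of_le (by norm_cast)) u (hu u hu') x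
        choose! L hL1 hL2 using this
        refine ⟨_, (HasFDerivAt.fun_sum fun u hu' =>
          (hL1 u hu').const_smul (shuffleCoeff w u : ℝ)).const_smul _, ?_⟩
        simp only [_root_.smul_apply, _root_.sum_apply]
        rw [hA, hB, ← Finset.sum_add_distrib]
        congr 1
        refine Finset.sum_congr rfl fun u hu' => ?_
        rw [hL2 u hu' j, smul_add]
      choose! L hL1 hL2 using hder
      have h := HasFDerivAt.fun_sum hL1
      rw [← ih'] at h
      rw [gammaWord, gamma, h.fderiv, _root_.sum_apply]
      exact Finset.sum_congr rfl hL2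
    have hR : ∀ k, k ≤ w.length →
        ∑ u ∈ Fintype.piFinset (fun _ : Fin (k + 1) => nonemptyWords d (w.length + 1)),
          (shuffleCoeff (j :: w) u : ℝ) •
            iteratedFDeriv ℝ (k + 1) φ x (fun l => field f (u l) x) =
        ((k + 1 : ℕ) : ℝ) • A k + B (k + 1) := fun k hk =>
      sum_shuffleCoeff_cons j w (fun v => field f v x) (fun v => iteratedFDeriv ℝ (k + 1) φ x v)
        fun l a v => iteratedFDeriv_insertNth (hφ.of_le (by norm_cast; omega)) l x a v
    have hB0 : B 0 = 0 := by simp [hB]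
    have hB1 : B (w.length + 1) = 0 := by
      refine Finset.sum_eq_zero fun u hu => ?_
      rw [shuffleCoeff_eq_zero_of_lt
        (fun l => (mem_nonemptyWords.1 (Fintype.mem_piFinset.1 hu l)).2) (by omega)]
      simp
    rw [hL, compLift_eq _ _ (le_refl (j :: w).length), List.length_cons, Finset.sum_range_succ']
    have hzero : ∑ u ∈ Fintype.piFinset (fun _ : Fin 0 => nonemptyWords d (w.length + 1)),
        (shuffleCoeff (j :: w) u : ℝ) • iteratedFDeriv ℝ 0 φ (field f [] x)
          (fun l => field f (u l) x) = 0 := by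
      refine Finset.sum_eq_zero fun u _ => ?_
      rw [shuffleCoeff_eq_zero (by simp)]
      simp
    rw [hzero, smul_zero, add_zero]
    -- The new letter can be a word of its own in any of k + 1 slots, and (k + 1)/(k + 1)! = 1/k!.
    -- So `A k` arises at index k + 1, and the shifted sum of `B` agrees with the original one
    -- because `B` vanishes at both ends.
    have e1 : ∀ k ∈ Finset.range (w.length + 1), ((Nat.factorial (k + 1) : ℝ)⁻¹) •
        ∑ u ∈ Fintype.piFinset (fun _ : Fin (k + 1) => nonemptyWords d (w.length + 1)),
          (shuffleCoeff (j :: w) u : ℝ) •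
            iteratedFDeriv ℝ (k + 1) φ (field f [] x) (fun l => field f (u l) x) =
        ((Nat.factorial k : ℝ)⁻¹) • A k + ((Nat.factorial (k + 1) : ℝ)⁻¹) • B (k + 1) := by
      intro k hk
      rw [Finset.mem_range] at hk
      have := hR k (by omega)
      simp only [field, id] at this ⊢
      rw [this, smul_add, smul_smul, Nat.factorial_succ]
      congr 2
      have : ((k + 1 : ℕ) : ℝ) ≠ 0 := by positivity
      push_cast at this ⊢
      field_simp
    rw [Finset.sum_congr rfl e1, Finset.sum_add_distrib]
    simp only [smul_add, Finset.sum_add_distrib]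
    congr 1
    have h1 := Finset.sum_range_succ' (fun k => ((Nat.factorial k : ℝ)⁻¹) • B k) (w.length + 1)
    have h2 := Finset.sum_range_succ (fun k => ((Nat.factorial k : ℝ)⁻¹) • B k) (w.length + 1)
    rw [hB0, smul_zero, add_zero] at h1
    rw [hB1, smul_zero, add_zero] at h2
    rw [← h1, h2]

end

/-! ### Transfer of expansions from a path to functions of it. -/

section

open Filter Asymptotics

variable {d : ℕ} {E F : Type*} [NormedAddCommGroup E] [NormedSpace ℝ E]
  [NormedAddCommGroup F] [NormedSpace ℝ F]

/-! ### Taylor expansions along controlled increments -/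

theorem isBigO_pow_of_le {ι : Type*} {l : Filter ι} {τ : ι → ℝ} (hτ : τ =O[l] fun _ => (1 : ℝ))
    {j k : ℕ} (h : k ≤ j) : (fun p => τ p ^ j) =O[l] fun p => τ p ^ k := by
  have := (isBigO_refl (fun p => τ p ^ k) l).mul (hτ.pow (j - k))
  simpa [← pow_add, Nat.add_sub_cancel' h] using this

/-- A bounded family lies in a compact ball, which makes all constants below uniform. -/
theorem isBigO_one_of_continuous {V V' : Type*} [NormedAddCommGroup V] [ProperSpace V]
    [NormedAddCommGroup V'] {ι : Type*} {S : Set ι} {x : ι → V} {R : ℝ}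
    (hx : ∀ p ∈ S, ‖x p‖ ≤ R) {G : V → V'} (hG : Continuous G) :
    (fun p => G (x p)) =O[𝓟 S] fun _ => (1 : ℝ) := by
  obtain ⟨C, hC⟩ := (isCompact_closedBall (0 : V) R).exists_bound_of_continuousOn hG.continuousOn
  refine isBigO_principal.2 ⟨C, fun p hp => ?_⟩
  simpa using hC (x p) (by simpa using hx p hp)

theorem isBigO_taylor_remainder [ProperSpace E] [CompleteSpace F] {ι : Type*} {S : Set ι}
    {x y : ι → E} {R : ℝ} (hx : ∀ p ∈ S, ‖x p‖ ≤ R) (hy : ∀ p ∈ S, ‖y p‖ ≤ R) {ψ : E → F} {K : ℕ}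
    (hψ : ContDiff ℝ (K + 1 : ℕ) ψ) :
    (fun p => ψ (y p) - ∑ k ∈ Finset.range (K + 1), ((Nat.factorial k : ℝ)⁻¹) •
      iteratedFDeriv ℝ k ψ (x p) fun _ => y p - x p) =O[𝓟 S] fun p => ‖y p - x p‖ ^ (K + 1) := by
  obtain ⟨C, hC⟩ := (isCompact_closedBall (0 : E) R).exists_bound_of_continuousOn
    (hψ.continuous_iteratedFDeriv (m := K + 1) le_rfl).continuousOn
  refine isBigO_principal.2 ⟨(Nat.factorial K : ℝ)⁻¹ * C, fun p hp => ?_⟩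
  have h := map_add_eq_sum_add_integral_iteratedFDeriv (f := ψ) (x := x p) (y := y p - x p)
    (n := K) fun t _ => by exact_mod_cast hψ.contDiffAt
  rw [add_sub_cancel] at h
  rw [h, add_sub_cancel_left, norm_smul, mul_assoc, norm_inv, Real.norm_natCast, norm_pow,
    norm_norm]
  gcongr
  refine (intervalIntegral.norm_integral_le_of_norm_le_const
    (C := C * ‖y p - x p‖ ^ (K + 1)) fun t ht => ?_).trans (by simp)
  rw [uIoc_of_le zero_le_one] at ht
  have hmem : x p + t • (y p - x p) ∈ Metric.closedBall (0 : E) R :=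
    (convex_closedBall (0 : E) R).add_smul_sub_mem (by simpa using hx p hp) (by simpa using hy p hp)
      ⟨ht.1.le, ht.2⟩
  rw [norm_smul, norm_pow, Real.norm_eq_abs, abs_of_nonneg (by linarith [ht.2])]
  have h1 : (1 - t) ^ K ≤ 1 := pow_le_one₀ (by linarith [ht.2]) (by linarith [ht.1])
  have h2 : ‖iteratedFDeriv ℝ (K + 1) ψ (x p + t • (y p - x p)) fun _ => y p - x p‖ ≤
      C * ‖y p - x p‖ ^ (K + 1) := by
    refine (ContinuousMultilinearMap.le_opNorm _ _).trans ?_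
    rw [Finset.prod_const, Finset.card_univ, Fintype.card_fin]
    gcongr
    exact hC _ hmem
  calc _ ≤ 1 * (C * ‖y p - x p‖ ^ (K + 1)) :=
        mul_le_mul h1 h2 (norm_nonneg _) zero_le_one
    _ = _ := one_mul _

theorem isBigO_multilinear_sub {ι : Type*} {S : Set ι} {k : ℕ}
    {A : ι → ContinuousMultilinearMap ℝ (fun _ : Fin k => E) F} {a b : ι → E}
    (hA : A =O[𝓟 S] fun _ => (1 : ℝ)) (ha : a =O[𝓟 S] fun _ => (1 : ℝ))
    (hb : b =O[𝓟 S] fun _ => (1 : ℝ)) :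
    (fun p => A p (fun _ => a p) - A p fun _ => b p) =O[𝓟 S] fun p => a p - b p := by
  obtain ⟨CA, hCA⟩ := isBigO_principal.1 hA
  obtain ⟨Ca, hCa⟩ := isBigO_principal.1 ha
  obtain ⟨Cb, hCb⟩ := isBigO_principal.1 hb
  simp only [norm_one, mul_one] at hCA hCa hCb
  refine isBigO_principal.2 ⟨CA * k * (max Ca Cb) ^ (k - 1), fun p hp => ?_⟩
  refine (ContinuousMultilinearMap.norm_image_sub_le _ _ _).trans ?_
  rw [Fintype.card_fin]
  have h0 : 0 ≤ CA := (norm_nonneg _).trans (hCA p hp)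
  have h1 : ‖fun _ : Fin k => a p‖ ≤ ‖a p‖ := pi_norm_const_le _
  have h2 : ‖fun _ : Fin k => b p‖ ≤ ‖b p‖ := pi_norm_const_le _
  have h3 : ‖(fun _ : Fin k => a p) - fun _ => b p‖ ≤ ‖a p - b p‖ :=
    pi_norm_const_le (a p - b p)
  have := hCA p hp
  have h4 : max ‖fun _ : Fin k => a p‖ ‖fun _ : Fin k => b p‖ ≤ max Ca Cb :=
    max_le_max (h1.trans (hCa p hp)) (h2.trans (hCb p hp))
  have h5 : 0 ≤ max ‖fun _ : Fin k => a p‖ ‖fun _ : Fin k => b p‖ :=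
    le_max_of_le_left (norm_nonneg _)
  gcongr
  exact mul_nonneg (by positivity) (pow_nonneg (h5.trans h4) _)

/-- If the increments of `x` are expanded along the fields `F_v` with coefficients given by
characters, then so are the increments of functions of `x`, along `Γ_v`. -/
theorem isBigO_sub_sum_gammaWord [ProperSpace E] [CompleteSpace F] {ι : Type*} {S : Set ι}
    {τ : ι → ℝ} (hτ : τ =O[𝓟 S] fun _ => (1 : ℝ)) {x y : ι → E} {R : ℝ}
    (hx : ∀ p ∈ S, ‖x p‖ ≤ R) (hy : ∀ p ∈ S, ‖y p‖ ≤ R) {K : ℕ} {g : ι → Word d → ℝ}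
    (hg : ∀ p ∈ S, IsTruncatedCharacter K (g p))
    (hgO : ∀ v : Word d, v.length ≤ K → (fun p => g p v) =O[𝓟 S] fun p => τ p ^ v.length)
    {f : Fin d → E → E} (hf : ∀ i, ContDiff ℝ K (f i))
    (hxy : (fun p => y p - ∑ v ∈ wordsLE d K, g p v • field f v (x p)) =O[𝓟 S]
      fun p => τ p ^ (K + 1))
    {ψ : E → F} (hψ : ContDiff ℝ (K + 1 : ℕ) ψ) :
    (fun p => ψ (y p) - ∑ v ∈ wordsLE d K, g p v • gammaWord f v ψ (x p)) =O[𝓟 S]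
      fun p => τ p ^ (K + 1) := by
  have hcf : ∀ v : Word d, v.length ≤ K → Continuous (field f v) := fun v hv =>
    (contDiff_field hf v 0 (by omega)).continuous
  -- The predicted increment; without the empty word it is of order τ.
  set P : ι → E := fun p => ∑ v ∈ nonemptyWords d K, g p v • field f v (x p) with hP
  have hPτ : P =O[𝓟 S] τ := by
    refine IsBigO.fun_sum fun v hv => ?_
    rw [mem_nonemptyWords] at hv
    have h1 : (fun p => g p v) =O[𝓟 S] τ := by
      simpa using (hgO v hv.1).trans (isBigO_pow_of_le hτ (List.length_pos_iff.2 hv.2))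
    simpa using h1.smul (isBigO_one_of_continuous hx (hcf v hv.1))
  have hhP : (fun p => (y p - x p) - P p) =O[𝓟 S] fun p => τ p ^ (K + 1) := by
    refine hxy.congr' ?_ EventuallyEq.rfl
    refine eventually_principal.2 fun p hp => ?_
    simp only [sum_wordsLE_eq_add, (hg p hp).one, one_smul, hP, field, id]
    abel
  have hhτ : (fun p => y p - x p) =O[𝓟 S] τ := by
    have h1 := (hhP.trans (isBigO_pow_of_le hτ (by omega : 1 ≤ K + 1)))
    simp only [pow_one] at h1
    exact (h1.add hPτ).congr_left fun p => by abel
  have hk : ∀ k ∈ Finset.range (K + 1), Continuous (iteratedFDeriv ℝ k ψ) := fun k hk =>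
    hψ.continuous_iteratedFDeriv (by have := Finset.mem_range.1 hk; norm_cast; omega)
  have hI : (fun p => ψ (y p) - ∑ k ∈ Finset.range (K + 1), ((Nat.factorial k : ℝ)⁻¹) •
      iteratedFDeriv ℝ k ψ (x p) fun _ => y p - x p) =O[𝓟 S] fun p => τ p ^ (K + 1) :=
    (isBigO_taylor_remainder hx hy hψ).trans (hhτ.norm_left.pow (K + 1))
  have hII : (fun p => ∑ k ∈ Finset.range (K + 1), ((Nat.factorial k : ℝ)⁻¹) •
      (iteratedFDeriv ℝ k ψ (x p) (fun _ => y p - x p) - iteratedFDeriv ℝ k ψ (x p) fun _ => P p))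
      =O[𝓟 S] fun p => τ p ^ (K + 1) :=
    IsBigO.fun_sum fun k hk' => ((isBigO_multilinear_sub
      (isBigO_one_of_continuous hx (hk k hk')) (hhτ.trans hτ) (hPτ.trans hτ)).trans hhP).const_smul_left _
  have hIII : (fun p => ∑ k ∈ Finset.range (K + 1), ((Nat.factorial k : ℝ)⁻¹) •
      ∑ u ∈ Fintype.piFinset (fun _ : Fin k => nonemptyWords d K),
        (∏ l, g p (u l) - ∑ v ∈ wordsLE d K, (shuffleCoeff v u : ℝ) * g p v) •
          iteratedFDeriv ℝ k ψ (x p) fun l => field f (u l) (x p))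
      =O[𝓟 S] fun p => τ p ^ (K + 1) := by
    refine IsBigO.fun_sum fun k hk' => IsBigO.const_smul_left (IsBigO.fun_sum fun u hu => ?_) _
    rw [Fintype.mem_piFinset] at hu
    simp only [mem_nonemptyWords] at hu
    have h1 : (fun p => ∏ l, g p (u l) - ∑ v ∈ wordsLE d K, (shuffleCoeff v u : ℝ) * g p v)
        =O[𝓟 S] fun p => τ p ^ (K + 1) := by
      -- Up to total length K the character property is exact. Beyond it the truncated shuffle sum
      -- vanishes, and the product itself has order at least K + 1.
      by_cases hlen : ∑ l, (u l).length ≤ K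
      · refine (isBigO_zero _ _).congr' ?_ EventuallyEq.rfl
        refine eventually_principal.2 fun p hp => ?_
        beta_reduce
        rw [(hg p hp).prod_eq u hlen, sub_self]
      · have h2 : ∀ p, ∑ v ∈ wordsLE d K, (shuffleCoeff v u : ℝ) * g p v = 0 := fun p =>
          Finset.sum_eq_zero fun v hv => by
            rw [mem_wordsLE] at hv
            rw [shuffleCoeff_eq_zero (by omega)]
            simp
        simp only [h2, sub_zero]
        have h3 : (fun p => ∏ l, g p (u l)) =O[𝓟 S] fun p => ∏ l, τ p ^ (u l).length :=
          IsBigO.finsetProd fun l _ => hgO (u l) (hu l).1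
        simp only [Finset.prod_pow_eq_pow_sum] at h3
        exact h3.trans (isBigO_pow_of_le hτ (by omega))
    have h2 : (fun p => iteratedFDeriv ℝ k ψ (x p) fun l => field f (u l) (x p))
        =O[𝓟 S] fun _ => (1 : ℝ) := by
      refine isBigO_one_of_continuous hx
        (G := fun z => iteratedFDeriv ℝ k ψ z fun l => field f (u l) z) ?_
      have h3 : Continuous fun z => fun l => field f (u l) z :=
        continuous_pi fun l => hcf _ (hu l).1
      exact (hk k hk').eval h3
    simpa using h1.smul h2
  refine ((hI.add hII).add hIII).congr_left fun p => ?_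
  have hA : ∀ v ∈ wordsLE d K, g p v • gammaWord f v ψ (x p) =
      ∑ k ∈ Finset.range (K + 1), ((Nat.factorial k : ℝ)⁻¹) •
        ∑ u ∈ Fintype.piFinset (fun _ : Fin k => nonemptyWords d K),
          ((shuffleCoeff v u : ℝ) * g p v) •
            iteratedFDeriv ℝ k ψ (x p) fun l => field f (u l) (x p) := by
    intro v hv
    rw [mem_wordsLE] at hv
    rw [← compLift_field hf v (hψ.of_le (by norm_cast; omega)) (by omega), compLift_eq _ _ hv,
      Finset.smul_sum]
    refine Finset.sum_congr rfl fun k _ => ?_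
    rw [smul_comm, Finset.smul_sum]
    congr 1
    refine Finset.sum_congr rfl fun u _ => ?_
    rw [smul_smul, mul_comm]
    rfl
  have hB : ∀ k, iteratedFDeriv ℝ k ψ (x p) (fun _ => P p) =
      ∑ u ∈ Fintype.piFinset (fun _ : Fin k => nonemptyWords d K),
        (∏ l, g p (u l)) • iteratedFDeriv ℝ k ψ (x p) fun l => field f (u l) (x p) := by
    intro k
    rw [hP]
    simp only
    rw [ContinuousMultilinearMap.map_sum_finset]
    exact Finset.sum_congr rfl fun u _ => ContinuousMultilinearMap.map_smul_univ _ _ _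
  rw [Finset.sum_congr rfl hA, Finset.sum_comm]
  simp only [hB, sub_smul, Finset.sum_sub_distrib, smul_sub, Finset.sum_smul,
    Finset.sum_comm (s := wordsLE d K), ← Finset.smul_sum]
  abel

end

/-! ### The sewing estimate along dyadic partitions. -/

section

open Filter

variable {E : Type*} [NormedAddCommGroup E]

/-! ### Sewing -/

/-- The point `k / 2^n` of the way from `s` to `t`. -/
def dyadic (s t : ℝ) (n k : ℕ) : ℝ := s + (t - s) * (k / 2 ^ n)

theorem dyadic_zero (s t : ℝ) (n : ℕ) : dyadic s t n 0 = s := by simp [dyadic]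

theorem dyadic_two_pow (s t : ℝ) (n : ℕ) : dyadic s t n (2 ^ n) = t := by simp [dyadic]

theorem dyadic_succ_double (s t : ℝ) (n k : ℕ) : dyadic s t (n + 1) (2 * k) = dyadic s t n k := by
  simp only [dyadic, pow_succ]
  push_cast
  field_simp

theorem dyadic_mono {s t : ℝ} (h : s ≤ t) (n : ℕ) : Monotone (dyadic s t n) := by
  intro i j hij
  unfold dyadic
  have : 0 ≤ t - s := by linarith
  have : (i : ℝ) ≤ j := by exact_mod_cast hij
  gcongr

theorem dyadic_strictMono {s t : ℝ} (h : s < t) (n : ℕ) : StrictMono (dyadic s t n) := by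
  intro i j hij
  unfold dyadic
  have h1 : 0 < t - s := by linarith
  have : (i : ℝ) < j := by exact_mod_cast hij
  gcongr

theorem dyadic_succ_sub (s t : ℝ) (n k : ℕ) :
    dyadic s t n (k + 1) - dyadic s t n k = (t - s) / 2 ^ n := by
  unfold dyadic
  push_cast
  ring

/-- The sum of `Ξ` over the `n`-th dyadic partition of `[s, t]`. -/
def dyadicSum (Ξ : ℝ → ℝ → E) (s t : ℝ) (n : ℕ) : E :=
  ∑ k ∈ Finset.range (2 ^ n), Ξ (dyadic s t n k) (dyadic s t n (k + 1))

theorem dyadicSum_zero (Ξ : ℝ → ℝ → E) (s t : ℝ) : dyadicSum Ξ s t 0 = Ξ s t := by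
  simp [dyadicSum, dyadic]

theorem sum_range_two_mul (m : ℕ) (a : ℕ → E) :
    ∑ k ∈ Finset.range (2 * m), a k = ∑ k ∈ Finset.range m, (a (2 * k) + a (2 * k + 1)) := by
  induction m with
  | zero => simp
  | succ m ih => rw [Nat.mul_succ, Finset.sum_range_succ, Finset.sum_range_succ, ih,
      Finset.sum_range_succ, add_assoc]

/-- Refining inserts 2^n midpoints, each costing C((t - s)/2^n)^θ; the total decays geometrically
with ratio 2^(1 - θ) once θ > 1. -/
theorem norm_dyadicSum_succ_sub_le {Ξ : ℝ → ℝ → E} {T C θ : ℝ}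
    (hΞ : ∀ s u t, 0 ≤ s → s < u → u < t → t ≤ T →
      ‖Ξ s t - (Ξ s u + Ξ u t)‖ ≤ C * (t - s) ^ θ)
    {s t : ℝ} (hs : 0 ≤ s) (hst : s < t) (ht : t ≤ T) (n : ℕ) :
    ‖dyadicSum Ξ s t n - dyadicSum Ξ s t (n + 1)‖ ≤
      C * (t - s) ^ θ * ((2 : ℝ) ^ (1 - θ)) ^ n := by
  have e : dyadicSum Ξ s t (n + 1) = ∑ k ∈ Finset.range (2 ^ n),
      (Ξ (dyadic s t n k) (dyadic s t (n + 1) (2 * k + 1)) +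
        Ξ (dyadic s t (n + 1) (2 * k + 1)) (dyadic s t n (k + 1))) := by
    rw [dyadicSum, pow_succ', sum_range_two_mul]
    refine Finset.sum_congr rfl fun k _ => ?_
    rw [dyadic_succ_double, ← dyadic_succ_double s t n (k + 1)]
    rfl
  rw [e, dyadicSum, ← Finset.sum_sub_distrib]
  refine (norm_sum_le_of_le (f := fun k => Ξ (dyadic s t n k) (dyadic s t n (k + 1)) -
    (Ξ (dyadic s t n k) (dyadic s t (n + 1) (2 * k + 1)) +
        Ξ (dyadic s t (n + 1) (2 * k + 1)) (dyadic s t n (k + 1))))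
    (n := fun _ => C * ((t - s) / 2 ^ n) ^ θ) _ fun k hk => ?_).trans_eq ?_
  · rw [← dyadic_succ_sub s t n k]
    rw [Finset.mem_range] at hk
    refine hΞ _ _ _ ?_ ?_ ?_ ?_
    · exact hs.trans ((dyadic_zero s t n).symm.le.trans (dyadic_mono hst.le n k.zero_le))
    · rw [← dyadic_succ_double]
      exact dyadic_strictMono hst (n + 1) (by omega)
    · rw [← dyadic_succ_double s t n (k + 1)]
      exact dyadic_strictMono hst (n + 1) (by omega)
    · exact ((dyadic_mono hst.le n hk).trans_eq (dyadic_two_pow s t n)).trans ht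
  · rw [Finset.sum_const, Finset.card_range, nsmul_eq_mul, Real.div_rpow (by linarith)
      (by positivity), ← Real.rpow_natCast, ← Real.rpow_natCast, ← Real.rpow_mul (by norm_num),
      ← Real.rpow_mul (by norm_num), sub_mul, Real.rpow_sub (by norm_num), one_mul]
    push_cast
    rw [mul_comm θ, Real.rpow_natCast]
    ring

theorem norm_dyadicSum_sub_le {Ξ : ℝ → ℝ → E} {T C θ : ℝ} (hC : 0 ≤ C) (hθ : 1 < θ)
    (hΞ : ∀ s u t, 0 ≤ s → s < u → u < t → t ≤ T →
      ‖Ξ s t - (Ξ s u + Ξ u t)‖ ≤ C * (t - s) ^ θ)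
    {s t : ℝ} (hs : 0 ≤ s) (hst : s < t) (ht : t ≤ T) (n : ℕ) :
    ‖dyadicSum Ξ s t n - Ξ s t‖ ≤ C * (1 - (2 : ℝ) ^ (1 - θ))⁻¹ * (t - s) ^ θ := by
  set q : ℝ := (2 : ℝ) ^ (1 - θ) with hq
  have hq0 : 0 < q := by positivity
  have hq1 : q < 1 := Real.rpow_lt_one_of_one_lt_of_neg (by norm_num) (by linarith)
  have h1 : dyadicSum Ξ s t n - Ξ s t =
      ∑ k ∈ Finset.range n, (dyadicSum Ξ s t (k + 1) - dyadicSum Ξ s t k) := by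
    rw [Finset.sum_range_sub, dyadicSum_zero]
  rw [h1]
  refine (norm_sum_le_of_le _ (n := fun k => C * (t - s) ^ θ * q ^ k) fun k _ => ?_).trans ?_
  · rw [norm_sub_rev]
    exact norm_dyadicSum_succ_sub_le hΞ hs hst ht k
  · rw [← Finset.mul_sum, mul_right_comm]
    have : 0 ≤ (t - s) ^ θ := Real.rpow_nonneg (by linarith) _
    gcongr
    rw [← tsum_geometric_of_lt_one hq0.le hq1]
    exact (summable_geometric_of_lt_one hq0.le hq1).sum_le_tsum _ fun _ _ => by positivity

/-- `L` is the limit of the Riemann sums of `Ξ` over partitions of `[0, t]`. -/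
def IsPartitionLimit (Ξ : ℝ → ℝ → E) (t : ℝ) (L : E) : Prop :=
  ∀ ε > 0, ∃ δ > 0, ∀ (m : ℕ) (p : ℕ → ℝ), Monotone p → p 0 = 0 → p m = t →
    (∀ k < m, p (k + 1) - p k < δ) → ‖(∑ k ∈ Finset.range m, Ξ (p k) (p (k + 1))) - L‖ < ε

/-- The concatenation of the `n`-th dyadic partitions of `[0, s]` and of `[s, t]`. -/
def dyadicConcat (s t : ℝ) (n k : ℕ) : ℝ :=
  if k ≤ 2 ^ n then dyadic 0 s n k else dyadic s t n (k - 2 ^ n)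

theorem dyadicConcat_add (s t : ℝ) (n k : ℕ) :
    dyadicConcat s t n (2 ^ n + k) = dyadic s t n k := by
  rcases Nat.eq_zero_or_pos k with rfl | h
  · rw [dyadicConcat, if_pos (by simp), add_zero, dyadic_two_pow, dyadic_zero]
  · rw [dyadicConcat, if_neg (by omega), Nat.add_sub_cancel_left]

theorem dyadicConcat_mono {s t : ℝ} (hs : 0 ≤ s) (hst : s ≤ t) (n : ℕ) :
    Monotone (dyadicConcat s t n) := by
  refine monotone_nat_of_le_succ fun k => ?_
  rcases lt_or_ge k (2 ^ n) with h | h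
  · rw [dyadicConcat, dyadicConcat, if_pos h.le, if_pos (Nat.succ_le_of_lt h)]
    exact dyadic_mono hs n k.le_succ
  · obtain ⟨k, rfl⟩ := Nat.exists_eq_add_of_le h
    rw [add_assoc, dyadicConcat_add, dyadicConcat_add]
    exact dyadic_mono hst n k.le_succ

theorem sum_dyadicConcat (Ξ : ℝ → ℝ → E) (s t : ℝ) (n : ℕ) :
    ∑ k ∈ Finset.range (2 ^ n + 2 ^ n), Ξ (dyadicConcat s t n k) (dyadicConcat s t n (k + 1)) =
      dyadicSum Ξ 0 s n + dyadicSum Ξ s t n := by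
  rw [Finset.sum_range_add]
  congr 1
  · refine Finset.sum_congr rfl fun k hk => ?_
    rw [Finset.mem_range] at hk
    rw [dyadicConcat, dyadicConcat, if_pos hk.le, if_pos (Nat.succ_le_of_lt hk)]
  · refine Finset.sum_congr rfl fun k _ => ?_
    rw [add_assoc, dyadicConcat_add, dyadicConcat_add]

theorem tendsto_div_two_pow (c : ℝ) : Tendsto (fun n : ℕ => c / 2 ^ n) atTop (nhds 0) := by
  have := (tendsto_pow_atTop_nhds_zero_of_lt_one (r := (1 / 2 : ℝ)) (by norm_num)
    (by norm_num)).const_mul c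
  simpa [div_eq_mul_inv] using this

theorem IsPartitionLimit.tendsto_dyadicSum_zero {Ξ : ℝ → ℝ → E} {s : ℝ} {L : E}
    (h : IsPartitionLimit Ξ s L) (hs : 0 ≤ s) :
    Tendsto (fun n => dyadicSum Ξ 0 s n) atTop (nhds L) := by
  refine Metric.tendsto_atTop'.2 fun ε hε => ?_
  obtain ⟨δ, hδ, H⟩ := h ε hε
  obtain ⟨n₀, hn₀⟩ := eventually_atTop.1 ((tendsto_div_two_pow (s - 0)).eventually (gt_mem_nhds hδ))
  refine ⟨n₀, fun n hn => ?_⟩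
  rw [dist_eq_norm]
  refine H (2 ^ n) (dyadic 0 s n) (dyadic_mono hs n) (dyadic_zero _ _ _) (dyadic_two_pow _ _ _)
    fun k _ => ?_
  rw [dyadic_succ_sub]
  exact hn₀ n hn.le

/-- Limits are given only for partitions starting at 0. Concatenating dyadic partitions of [0, s]
and [s, t] gives one of [0, t], and the part over [0, s] is subtracted. -/
theorem IsPartitionLimit.tendsto_dyadicSum {Ξ : ℝ → ℝ → E} {s t : ℝ} {L L' : E}
    (h : IsPartitionLimit Ξ s L) (h' : IsPartitionLimit Ξ t L') (hs : 0 ≤ s) (hst : s ≤ t) :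
    Tendsto (fun n => dyadicSum Ξ s t n) atTop (nhds (L' - L)) := by
  have key : Tendsto (fun n => dyadicSum Ξ 0 s n + dyadicSum Ξ s t n) atTop (nhds L') := by
    refine Metric.tendsto_atTop'.2 fun ε hε => ?_
    obtain ⟨δ, hδ, H⟩ := h' ε hε
    obtain ⟨n₀, hn₀⟩ := eventually_atTop.1
      (((tendsto_div_two_pow (s - 0)).eventually (gt_mem_nhds hδ)).and
        ((tendsto_div_two_pow (t - s)).eventually (gt_mem_nhds hδ)))
    refine ⟨n₀, fun n hn => ?_⟩
    rw [dist_eq_norm, ← sum_dyadicConcat]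
    refine H _ (dyadicConcat s t n) (dyadicConcat_mono hs hst n) ?_ ?_ fun k hk => ?_
    · rw [dyadicConcat, if_pos (Nat.zero_le _), dyadic_zero]
    · rw [dyadicConcat_add, dyadic_two_pow]
    · rcases lt_or_ge k (2 ^ n) with h | h
      · rw [dyadicConcat, dyadicConcat, if_pos h.le, if_pos (Nat.succ_le_of_lt h), dyadic_succ_sub]
        exact (hn₀ n hn.le).1
      · obtain ⟨k, rfl⟩ := Nat.exists_eq_add_of_le h
        rw [add_assoc, dyadicConcat_add, dyadicConcat_add, dyadic_succ_sub]
        exact (hn₀ n hn.le).2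
  simpa using key.sub (h.tendsto_dyadicSum_zero hs)

/-- The error bound of the sewing lemma, for a two-parameter function whose Riemann sums are known
to converge. -/
theorem norm_partitionLimit_sub_le {Ξ : ℝ → ℝ → E} {T C θ : ℝ} (hC : 0 ≤ C) (hθ : 1 < θ)
    (hΞ : ∀ s u t, 0 ≤ s → s < u → u < t → t ≤ T →
      ‖Ξ s t - (Ξ s u + Ξ u t)‖ ≤ C * (t - s) ^ θ)
    {J : ℝ → E} (hJ : ∀ t ∈ Icc 0 T, IsPartitionLimit Ξ t (J t))
    {s t : ℝ} (hs : 0 ≤ s) (hst : s < t) (ht : t ≤ T) :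
    ‖J t - J s - Ξ s t‖ ≤ C * (1 - (2 : ℝ) ^ (1 - θ))⁻¹ * (t - s) ^ θ :=
  le_of_tendsto (((hJ s ⟨hs, hst.le.trans ht⟩).tendsto_dyadicSum (hJ t ⟨hs.trans hst.le, ht⟩) hs
    hst.le).sub_const _).norm
    (Eventually.of_forall fun n => norm_dyadicSum_sub_le hC hθ hΞ hs hst ht n)

end

/-! ### Orders in |t - s|^γ, and solutions of the differential equation. -/

section

open Filter Asymptotics

variable {d : ℕ} {E F : Type*} [NormedAddCommGroup E] [NormedSpace ℝ E]
  [NormedAddCommGroup F] [NormedSpace ℝ F]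

/-! ### Expansions over ordered pairs of times -/

/-- The ordered pairs of times in `[0, T]`. -/
def orderedPairs (T : ℝ) : Set (ℝ × ℝ) := {p | 0 ≤ p.1 ∧ p.1 < p.2 ∧ p.2 ≤ T}

theorem orderedPairs.fst_mem {T : ℝ} {p : ℝ × ℝ} (hp : p ∈ orderedPairs T) : p.1 ∈ Icc 0 T :=
  ⟨hp.1, hp.2.1.le.trans hp.2.2⟩

theorem orderedPairs.snd_mem {T : ℝ} {p : ℝ × ℝ} (hp : p ∈ orderedPairs T) : p.2 ∈ Icc 0 T :=
  ⟨hp.1.trans hp.2.1.le, hp.2.2⟩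

/-- The scale `|t - s|^γ` at the pair `(s, t)`. -/
def scale (γ : ℝ) (p : ℝ × ℝ) : ℝ := |p.2 - p.1| ^ γ

theorem scale_nonneg (γ : ℝ) (p : ℝ × ℝ) : 0 ≤ scale γ p := Real.rpow_nonneg (abs_nonneg _) _

theorem scale_pow (γ : ℝ) (s t : ℝ) (k : ℕ) : scale γ (s, t) ^ k = |t - s| ^ ((k : ℝ) * γ) := by
  rw [mul_comm, Real.rpow_mul_natCast (abs_nonneg _), scale]

theorem isBigO_scale_one {γ : ℝ} (hγ : 0 ≤ γ) (T : ℝ) :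
    scale γ =O[𝓟 (orderedPairs T)] fun _ => (1 : ℝ) := by
  refine isBigO_principal.2 ⟨T ^ γ, fun p hp => ?_⟩
  rw [Real.norm_of_nonneg (scale_nonneg γ p), norm_one, mul_one, scale]
  refine Real.rpow_le_rpow (abs_nonneg _) ?_ hγ
  rw [abs_of_nonneg (by linarith [hp.2.1])]
  linarith [hp.1, hp.2.2]

theorem one_le_level {γ : ℝ} (hγ : 0 < γ) (hγ_lt : γ < 1) : 1 ≤ level γ :=
  Nat.le_floor (by simpa using (one_le_inv₀ hγ).2 hγ_lt.le)

/-- The reason for the choice of truncation level: order N + 1 is the first one guaranteed to exceed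
exponent 1, as sewing demands. -/
theorem one_lt_level_add_one_mul {γ : ℝ} (hγ : 0 < γ) : 1 < ((level γ + 1 : ℕ) : ℝ) * γ := by
  have := Nat.lt_floor_add_one γ⁻¹
  calc 1 = γ⁻¹ * γ := (inv_mul_cancel₀ hγ.ne').symm
    _ < _ := by
      push_cast
      exact mul_lt_mul_of_pos_right this hγ

/-- Lowering the order of an expansion. -/
theorem isBigO_sub_sum_of_le {ι : Type*} {l : Filter ι} {τ : ι → ℝ}
    (hτ : τ =O[l] fun _ => (1 : ℝ)) {y : ι → E} {K M : ℕ} (hK : K ≤ M) {g : ι → Word d → ℝ}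
    (hg : ∀ v : Word d, v.length ≤ M → (fun p => g p v) =O[l] fun p => τ p ^ v.length)
    {G : Word d → ι → E}
    (hG : ∀ v : Word d, v.length ≤ M → G v =O[l] fun _ => (1 : ℝ))
    (h : (fun p => y p - ∑ v ∈ wordsLE d M, g p v • G v p) =O[l] fun p => τ p ^ (M + 1)) :
    (fun p => y p - ∑ v ∈ wordsLE d K, g p v • G v p) =O[l] fun p => τ p ^ (K + 1) := by
  have hsub : wordsLE d K ⊆ wordsLE d M := fun v hv => by
    rw [mem_wordsLE] at hv ⊢
    omega
  have h1 : (fun p => ∑ v ∈ wordsLE d M \ wordsLE d K, g p v • G v p) =O[l]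
      fun p => τ p ^ (K + 1) := by
    refine IsBigO.fun_sum fun v hv => ?_
    simp only [Finset.mem_sdiff, mem_wordsLE] at hv
    have := ((hg v hv.1).trans (isBigO_pow_of_le hτ (by omega : K + 1 ≤ v.length))).smul
      (hG v hv.1)
    simpa using this
  refine ((h.trans (isBigO_pow_of_le hτ (by omega))).add h1).congr_left fun p => ?_
  rw [← Finset.sum_sdiff hsub]
  abel

theorem conv_concat (g h : Word d → ℝ) (w : Word d) (i : Fin d) :
    conv g h (w ++ [i]) = g (w ++ [i]) * h [] +
      ∑ k ∈ Finset.range (w.length + 1), g (w.take k) * h (w.drop k ++ [i]) := by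
  rw [conv, List.length_append, List.length_singleton, Finset.sum_range_succ, add_comm]
  congr 1
  · rw [List.take_of_length_le (by simp), List.drop_of_length_le (by simp)]
  · refine Finset.sum_congr rfl fun k hk => ?_
    have : k ≤ w.length := by simpa [Nat.lt_succ_iff] using hk
    rw [List.take_append_of_le_length this, List.drop_append_of_le_length this]

theorem sum_nonemptyWords_succ {M : Type*} [AddCommMonoid M] (K : ℕ) (H : Word d → M) :
    ∑ v ∈ nonemptyWords d (K + 1), H v = ∑ i, ∑ w ∈ wordsLE d K, H (w ++ [i]) := by
  rw [← Finset.sum_product']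
  symm
  refine Finset.sum_bij (fun p _ => p.2 ++ [p.1]) ?_ ?_ ?_ fun _ _ => rfl
  · rintro ⟨i, w⟩ h
    simpa [mem_wordsLE, mem_nonemptyWords] using h
  · rintro ⟨i, w⟩ _ ⟨j, v⟩ _ h
    have := List.append_inj' h rfl
    simp only [List.cons.injEq, and_true] at this
    exact Prod.ext this.2 this.1
  · intro v hv
    rw [mem_nonemptyWords] at hv
    refine ⟨(v.getLast hv.2, v.dropLast), ?_, List.dropLast_append_getLast hv.2⟩
    simp [mem_wordsLE]
    omega

section RDE

variable {γ T : ℝ} {W : ℝ → Word d → ℝ}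

theorem IsGeometricRoughPath.isBigO_incr (hW : IsGeometricRoughPath γ T W) {w : Word d}
    (hw : w.length ≤ level γ) :
    (fun p : ℝ × ℝ => incr W p.1 p.2 w) =O[𝓟 (orderedPairs T)] fun p => scale γ p ^ w.length := by
  obtain ⟨C, hC⟩ := hW.incr_bound hw
  refine isBigO_principal.2 ⟨C, fun p hp => ?_⟩
  rw [Real.norm_of_nonneg (pow_nonneg (scale_nonneg γ p) _)]
  exact hC _ (orderedPairs.fst_mem hp) _ (orderedPairs.snd_mem hp)

theorem integralLift_concat {V : Type*} [NormedAddCommGroup V] (i j : Fin d) (J : V)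
    (y : Word d → V) (w : Word d) :
    integralLift i J y (w ++ [j]) = if j = i then y w else 0 := by
  simp [integralLift]

/-- A controlled path solving an RDE is the one made of the iterated vector fields along its
trace. -/
theorem coord_eq_field {N : ℕ} {f : Fin d → E → E} (hf : ∀ i, ContDiff ℝ N (f i)) {x : E}
    {X : ℝ → E} {Y : ℝ → Word d → E} (hT : 0 ≤ T) (hYX : ∀ t ∈ Icc 0 T, Y t [] = X t)
    (hY0 : ∀ w : Word d, w.length < N → Y 0 w = field f w x) {J : Fin d → ℝ → E}
    (hN : 0 < N)
    (hY : ∀ s ∈ Icc 0 T, ∀ t ∈ Icc 0 T, ∀ w : Word d, w.length < N →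
        Y t w - Y s w =
          ∑ i, (integralLift i (J i t) (compLift (f i) (Y t)) w
            - integralLift i (J i s) (compLift (f i) (Y s)) w))
    (w : Word d) (hw : w.length < N) : ∀ t ∈ Icc 0 T, Y t w = field f w (X t) := by
  have h0 : (0 : ℝ) ∈ Icc 0 T := ⟨le_rfl, hT⟩
  have hX0 : X 0 = x := by
    rw [← hYX 0 h0, hY0 [] (by simpa using hN)]
    rfl
  induction hn : w.length using Nat.strong_induction_on generalizing w with
  | _ n ih =>
    intro t ht
    rcases List.eq_nil_or_concat' w with rfl | ⟨u, i, rfl⟩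
    · exact hYX t ht
    · simp only [List.length_append, List.length_singleton] at hn hw
      have hcomp : ∀ t ∈ Icc 0 T, compLift (f i) (Y t) u = field f (u ++ [i]) (X t) := by
        intro t ht
        rw [compLift_congr (f i) (z := fun v => field f v (X t)) fun v hv =>
          ih v.length (by omega) v (by omega) rfl t ht, compLift_field hf u
            ((hf i).of_le (by norm_cast; omega)) (by omega), field_concat]
      -- At `u ++ [i]` only the i-th integral contributes, with the coordinate of the composition at
      -- u, known by induction. The coordinate and F_{ui}(X) thus have equal increments from time 0,
      -- where they agree.
      have := hY 0 h0 t ht (u ++ [i]) (by simpa using hw)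
      simp only [integralLift_concat, Finset.sum_sub_distrib, Finset.sum_ite_eq, Finset.mem_univ,
        if_true, hcomp t ht, hcomp 0 h0, hX0, hY0 (u ++ [i]) (by simpa using hw)] at this
      exact sub_left_injective this

/-- The local approximation of the rough integral of `f_i` along a solution. -/
def davieTerm (N : ℕ) (W : ℝ → Word d → ℝ) (f : Fin d → E → E) (X : ℝ → E) (i : Fin d)
    (s t : ℝ) : E :=
  ∑ w ∈ wordsLE d (N - 1), incr W s t (w ++ [i]) • field f (w ++ [i]) (X s)

/-- Chen's relation cuts `w ++ [i]` at u. The cut leaving nothing for [u, t] cancels the germ on [s,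
u]; the other cuts group into expansions of F_{bi}(X_u) around X_s. -/
theorem davieTerm_sub (hW : IsGeometricRoughPath γ T W) (hN : 1 ≤ level γ) (f : Fin d → E → E)
    (X : ℝ → E) (i : Fin d) {s u t : ℝ} (hu : u ∈ Icc 0 T) (ht : t ∈ Icc 0 T) :
    davieTerm (level γ) W f X i s t -
        (davieTerm (level γ) W f X i s u + davieTerm (level γ) W f X i u t) =
      ∑ b ∈ wordsLE d (level γ - 1), incr W u t (b ++ [i]) •
        (∑ a ∈ wordsLE d (level γ - 1 - b.length), incr W s u a • field f (a ++ b ++ [i]) (X s) -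
          field f (b ++ [i]) (X u)) := by
  simp only [davieTerm, smul_sub, Finset.sum_sub_distrib, Finset.smul_sum]
  rw [sum_wordsLE_append (level γ - 1) fun a b =>
    incr W u t (b ++ [i]) • incr W s u a • field f (a ++ b ++ [i]) (X s), ← sub_sub]
  congr 1
  rw [← Finset.sum_sub_distrib]
  refine Finset.sum_congr rfl fun w hw => ?_
  rw [mem_wordsLE] at hw
  rw [← hW.conv_incr hu (w := w ++ [i]) (by simp; omega), conv_concat,
    (hW.incr_character hu ht).one, mul_one, ← sub_smul, add_sub_cancel_left, Finset.sum_smul]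
  refine Finset.sum_congr rfl fun k _ => ?_
  rw [List.take_append_drop, smul_smul, mul_comm]

end RDE

end

/-! ### Davie's expansion and reversal of time. -/

section

open Filter Asymptotics

variable {d : ℕ} {E F : Type*} [NormedAddCommGroup E] [NormedSpace ℝ E]
  [NormedAddCommGroup F] [NormedSpace ℝ F] {γ T : ℝ} {W : ℝ → Word d → ℝ}
  {f : Fin d → E → E} {X : ℝ → E}

/-- Expansions of `X` along the fields `F_v` yield expansions of `Γ_w ψ(X)` of all lower orders. -/
theorem isBigO_gammaWord_sub [ProperSpace E] [CompleteSpace F] (hγ : 0 ≤ γ)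
    (hW : IsGeometricRoughPath γ T W) {M : ℕ} (hM : M ≤ level γ) (hf : ∀ i, ContDiff ℝ M (f i)) {R : ℝ}
    (hR : ∀ t ∈ Icc 0 T, ‖X t‖ ≤ R)
    (hX : (fun p : ℝ × ℝ => X p.2 - ∑ v ∈ wordsLE d M, incr W p.1 p.2 v • field f v (X p.1))
      =O[𝓟 (orderedPairs T)] fun p => scale γ p ^ (M + 1))
    {ψ : E → F} (hψ : ContDiff ℝ (M + 1 : ℕ) ψ) {w : Word d} (hw : w.length ≤ M) :
    (fun p : ℝ × ℝ => gammaWord f w ψ (X p.2) -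
        ∑ v ∈ wordsLE d (M - w.length), incr W p.1 p.2 v • gammaWord f (v ++ w) ψ (X p.1))
      =O[𝓟 (orderedPairs T)] fun p => scale γ p ^ (M + 1 - w.length) := by
  have hτ := isBigO_scale_one hγ T
  have hR1 : ∀ p ∈ orderedPairs T, ‖X p.1‖ ≤ R := fun p hp => hR _ (orderedPairs.fst_mem hp)
  have hR2 : ∀ p ∈ orderedPairs T, ‖X p.2‖ ≤ R := fun p hp => hR _ (orderedPairs.snd_mem hp)
  -- Γ_w ψ has only M - |w| + 1 derivatives, so the expansion of X is first truncated to the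
  -- matching order.
  have hX' := isBigO_sub_sum_of_le (K := M - w.length) hτ (Nat.sub_le _ _)
    (g := fun p : ℝ × ℝ => incr W p.1 p.2)
    (G := fun v p => field f v (X p.1)) (fun v hv => hW.isBigO_incr (hv.trans hM))
    (fun v hv => isBigO_one_of_continuous hR1 (contDiff_field hf v 0 (by omega)).continuous) hX
  have hψ' : ContDiff ℝ (M - w.length + 1 : ℕ) (gammaWord f w ψ) :=
    contDiff_gammaWord hf w _ (hψ.of_le (by norm_cast; omega)) (by omega)
  have := isBigO_sub_sum_gammaWord hτ hR1 hR2 (K := M - w.length)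
    (g := fun p : ℝ × ℝ => incr W p.1 p.2)
    (fun p hp => (hW.incr_character (orderedPairs.fst_mem hp) (orderedPairs.snd_mem hp)).mono
      (by omega))
    (fun v hv => hW.isBigO_incr (by omega)) (fun i => (hf i).of_le (by norm_cast; omega)) hX' hψ'
  simp only [gammaWord_append]
  rwa [show M + 1 - w.length = M - w.length + 1 by omega]

/-- The coordinate at bi has order |b| + 1, and the remainder of F_{bi}(X) = Γ_b f_i(X) has order N
- |b|: every product has order N + 1. The transfer is used at level N - 1, for which f_i of class
C^N suffices. -/
theorem norm_davieTerm_sub_le [ProperSpace E] (hγ : 0 ≤ γ) (hW : IsGeometricRoughPath γ T W)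
    (hN : 1 ≤ level γ) (hf : ∀ i, ContDiff ℝ (level γ) (f i)) {R : ℝ} (hR : ∀ t ∈ Icc 0 T, ‖X t‖ ≤ R)
    (hX : (fun p : ℝ × ℝ => X p.2 -
        ∑ v ∈ wordsLE d (level γ - 1), incr W p.1 p.2 v • field f v (X p.1))
      =O[𝓟 (orderedPairs T)] fun p => scale γ p ^ level γ) (i : Fin d) :
    ∃ C, 0 ≤ C ∧ ∀ s u t, 0 ≤ s → s < u → u < t → t ≤ T →
      ‖davieTerm (level γ) W f X i s t -
        (davieTerm (level γ) W f X i s u + davieTerm (level γ) W f X i u t)‖ ≤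
      C * (t - s) ^ (((level γ + 1 : ℕ) : ℝ) * γ) := by
  have hcompl : CompleteSpace E := inferInstance
  have h1 : ∀ b ∈ wordsLE d (level γ - 1), ∃ C, ∀ p ∈ orderedPairs T,
      ‖incr W p.1 p.2 (b ++ [i])‖ ≤ C * ‖scale γ p ^ (b.length + 1)‖ := fun b hb => by
    rw [mem_wordsLE] at hb
    simpa using isBigO_principal.1 (hW.isBigO_incr (w := b ++ [i]) (by simp; omega))
  have h2 : ∀ b ∈ wordsLE d (level γ - 1), ∃ C, ∀ p ∈ orderedPairs T,
      ‖field f (b ++ [i]) (X p.2) - ∑ a ∈ wordsLE d (level γ - 1 - b.length),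
        incr W p.1 p.2 a • field f (a ++ b ++ [i]) (X p.1)‖ ≤
        C * ‖scale γ p ^ (level γ - b.length)‖ := fun b hb => by
    rw [mem_wordsLE] at hb
    have := isBigO_gammaWord_sub hγ hW (M := level γ - 1) (by omega)
      (fun i => (hf i).of_le (by norm_cast; omega)) hR (by rwa [Nat.sub_add_cancel hN])
      (ψ := f i) ((hf i).of_le (by norm_cast; omega)) hb
    rw [Nat.sub_add_cancel hN] at this
    simpa only [field_concat] using isBigO_principal.1 this
  choose! A hA using h1
  choose! B hB using h2
  refine ⟨∑ b ∈ wordsLE d (level γ - 1), |A b| * |B b|, by positivity,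
    fun s u t hs hsu hut ht => ?_⟩
  rw [davieTerm_sub hW hN f X i ⟨by linarith, by linarith⟩ ⟨by linarith, ht⟩, Finset.sum_mul]
  refine norm_sum_le_of_le _ fun b hb => ?_
  have e : (t - s) ^ (((level γ + 1 : ℕ) : ℝ) * γ) =
      scale γ (s, t) ^ (b.length + 1) * scale γ (s, t) ^ (level γ - b.length) := by
    rw [mem_wordsLE] at hb
    rw [← pow_add, show b.length + 1 + (level γ - b.length) = level γ + 1 by omega, scale_pow,
      abs_of_pos (by linarith)]
  have m1 : scale γ (u, t) ≤ scale γ (s, t) := by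
    refine Real.rpow_le_rpow (abs_nonneg _) ?_ hγ
    simp only
    rw [abs_of_pos (by linarith), abs_of_pos (by linarith)]
    linarith
  have m2 : scale γ (s, u) ≤ scale γ (s, t) := by
    refine Real.rpow_le_rpow (abs_nonneg _) ?_ hγ
    simp only
    rw [abs_of_pos (by linarith), abs_of_pos (by linarith)]
    linarith
  have b1 := hA b hb (u, t) ⟨by simp only; linarith, hut, ht⟩
  have b2 := hB b hb (s, u) ⟨hs, hsu, by simp only; linarith⟩
  rw [norm_pow, Real.norm_of_nonneg (scale_nonneg _ _)] at b1 b2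
  have n1 := scale_nonneg γ (u, t)
  have n2 := scale_nonneg γ (s, u)
  have b1' : ‖incr W u t (b ++ [i])‖ ≤ |A b| * scale γ (s, t) ^ (b.length + 1) :=
    b1.trans (by gcongr; exact le_abs_self _)
  have b2' := b2.trans (show _ ≤ |B b| * scale γ (s, t) ^ (level γ - b.length) by
    gcongr; exact le_abs_self _)
  rw [norm_smul, norm_sub_rev, e, mul_mul_mul_comm]
  exact mul_le_mul b1' b2' (norm_nonneg _) (by positivity [scale_nonneg γ (s, t)])

theorem exists_bound_of_holder {V : Type*} [NormedAddCommGroup V] {X : ℝ → V}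
    (hγ : 0 ≤ γ) {C : ℝ}
    (h : ∀ s ∈ Icc 0 T, ∀ t ∈ Icc 0 T, ‖X t - X s‖ ≤ C * |t - s| ^ γ) :
    ∃ R, ∀ t ∈ Icc 0 T, ‖X t‖ ≤ R := by
  refine ⟨|C| * T ^ γ + ‖X 0‖, fun t ht => ?_⟩
  have h1 := h 0 ⟨le_rfl, ht.1.trans ht.2⟩ t ht
  have h2 : |t - 0| ^ γ ≤ T ^ γ := by
    refine Real.rpow_le_rpow (abs_nonneg _) ?_ hγ
    rw [sub_zero, abs_of_nonneg ht.1]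
    exact ht.2
  calc ‖X t‖ = ‖(X t - X 0) + X 0‖ := by rw [sub_add_cancel]
    _ ≤ ‖X t - X 0‖ + ‖X 0‖ := norm_add_le _ _
    _ ≤ |C| * T ^ γ + ‖X 0‖ := by
      gcongr
      refine h1.trans ?_
      have : 0 ≤ |t - 0| ^ γ := by positivity
      gcongr
      exact le_abs_self _

/-- Davie's expansion: a solution is bounded, and its increments are expanded along the iterated
vector fields up to the order of the rough path. -/
theorem IsRDESolution.davie [ProperSpace E] (hγ : 0 < γ) (hγ_lt : γ < 1) (hT : 0 ≤ T)
    (hW : IsGeometricRoughPath γ T W) (hf : ∀ i, ContDiff ℝ (level γ) (f i)) {x : E}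
    (hX : IsRDESolution γ T W f x X) :
    (∃ R, ∀ t ∈ Icc 0 T, ‖X t‖ ≤ R) ∧
    (fun p : ℝ × ℝ => X p.2 - ∑ v ∈ wordsLE d (level γ), incr W p.1 p.2 v • field f v (X p.1))
      =O[𝓟 (orderedPairs T)] fun p => scale γ p ^ (level γ + 1) := by
  obtain ⟨Y, hYc, hYX, hY0, J, hJ, hYJ⟩ := hX
  have hN := one_le_level hγ hγ_lt
  have hfield := coord_eq_field hf hT hYX hY0 hN hYJ
  have hbdd : ∃ R, ∀ t ∈ Icc 0 T, ‖X t‖ ≤ R := by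
    obtain ⟨C, hC⟩ := hYc.holder [] hN
    refine exists_bound_of_holder hγ.le (C := C) fun s hs t ht => ?_
    rw [← hYX s hs, ← hYX t ht]
    exact hC s hs t ht
  refine ⟨hbdd, ?_⟩
  obtain ⟨R, hR⟩ := hbdd
  -- The controlled remainder at the empty word, with the coordinates replaced by F_v(X): an
  -- expansion of order N, to be improved by one.
  have hexp : (fun p : ℝ × ℝ => X p.2 -
        ∑ v ∈ wordsLE d (level γ - 1), incr W p.1 p.2 v • field f v (X p.1))
      =O[𝓟 (orderedPairs T)] fun p => scale γ p ^ level γ := by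
    obtain ⟨C, hC⟩ := hYc.remainder [] hN
    refine isBigO_principal.2 ⟨C, fun p hp => ?_⟩
    have := hC _ (orderedPairs.fst_mem hp) _ (orderedPairs.snd_mem hp) hp.2.1
    simp only [List.length_nil, Nat.sub_zero, List.append_nil, Nat.cast_zero, sub_zero,
      hYX _ (orderedPairs.snd_mem hp)] at this
    rw [Real.norm_of_nonneg (pow_nonneg (scale_nonneg γ p) _), scale_pow]
    convert this using 3
    refine Finset.sum_congr rfl fun v hv => ?_
    rw [mem_wordsLE] at hv
    rw [hfield v (by omega) _ (orderedPairs.fst_mem hp)]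
  have hcomp : ∀ i, ∀ t ∈ Icc 0 T, ∀ w : Word d, w.length ≤ level γ - 1 →
      compLift (f i) (Y t) w = field f (w ++ [i]) (X t) := by
    intro i t ht w hw
    rw [compLift_congr (f i) (z := fun v => field f v (X t)) fun v hv =>
      hfield v (by omega) t ht, compLift_field hf w ((hf i).of_le (by norm_cast; omega)) (by omega),
      field_concat]
  have hlim : ∀ i, ∀ t ∈ Icc 0 T,
      IsPartitionLimit (davieTerm (level γ) W f X i) t (J i t) := by
    intro i t ht ε hε
    obtain ⟨δ, hδ, H⟩ := hJ i t ht ε hε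
    refine ⟨δ, hδ, fun m p hp h0 hm hmesh => ?_⟩
    convert H m p hp h0 hm hmesh using 3
    refine Finset.sum_congr rfl fun k hk => ?_
    rw [Finset.mem_range] at hk
    refine Finset.sum_congr rfl fun w hw => ?_
    beta_reduce
    rw [hcomp i (p k) ⟨h0.symm.le.trans (hp k.zero_le), ((hp hk.le).trans_eq hm).trans ht.2⟩ w
      (mem_wordsLE.1 hw)]
  have hsew : ∀ i, ∃ C, ∀ p ∈ orderedPairs T,
      ‖J i p.2 - J i p.1 - davieTerm (level γ) W f X i p.1 p.2‖ ≤
        C * ‖scale γ p ^ (level γ + 1)‖ := by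
    intro i
    obtain ⟨C, hC0, hC⟩ := norm_davieTerm_sub_le hγ.le hW hN hf hR hexp i
    refine ⟨C * (1 - (2 : ℝ) ^ (1 - ((level γ + 1 : ℕ) : ℝ) * γ))⁻¹,
      fun p hp => (norm_partitionLimit_sub_le hC0 (one_lt_level_add_one_mul hγ) hC
      (hlim i) hp.1 hp.2.1 hp.2.2).trans_eq ?_⟩
    rw [Real.norm_of_nonneg (pow_nonneg (scale_nonneg γ p) _), scale_pow,
      abs_of_pos (by linarith [hp.2.1])]
  have hsum : (fun p : ℝ × ℝ => ∑ i, (J i p.2 - J i p.1 - davieTerm (level γ) W f X i p.1 p.2))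
      =O[𝓟 (orderedPairs T)] fun p => scale γ p ^ (level γ + 1) :=
    IsBigO.fun_sum fun i _ => isBigO_principal.2 (hsew i)
  refine hsum.congr' ?_ EventuallyEq.rfl
  refine eventually_principal.2 fun p hp => ?_
  have h1 := orderedPairs.fst_mem hp
  have h2 := orderedPairs.snd_mem hp
  have hinc := hYJ _ h1 _ h2 [] hN
  simp only [integralLift, if_true, hYX _ h1, hYX _ h2] at hinc
  have hsplit : ∑ v ∈ wordsLE d (level γ), incr W p.1 p.2 v • field f v (X p.1) =
      X p.1 + ∑ i, davieTerm (level γ) W f X i p.1 p.2 := by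
    rw [sum_wordsLE_eq_add, (hW.incr_character h1 h2).one, one_smul]
    obtain ⟨K, hK⟩ := Nat.exists_eq_add_of_le' hN
    simp only [davieTerm, hK, sum_nonemptyWords_succ, Nat.add_sub_cancel]
    rfl
  simp only [hsplit]
  rw [Finset.sum_sub_distrib, ← hinc]
  abel

/-- The remainder at reversed times, in terms of the remainders at ordered times. -/
theorem sub_sum_incr_reverse (hW : IsGeometricRoughPath γ T W) {s t : ℝ} (hs : s ∈ Icc 0 T)
    (ht : t ∈ Icc 0 T) (φ : E → F) {K : ℕ} (hK : K ≤ level γ) (w : Word d) :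
    gammaWord f w φ (X t) - ∑ v ∈ wordsLE d K, incr W s t v • gammaWord f (v ++ w) φ (X s) =
      -∑ v ∈ wordsLE d K, incr W s t v • (gammaWord f (v ++ w) φ (X s) -
        ∑ u ∈ wordsLE d (K - v.length),
          incr W t s u • gammaWord f (u ++ (v ++ w)) φ (X t)) := by
  simp only [smul_sub, Finset.sum_sub_distrib, Finset.smul_sum]
  rw [sum_wordsLE_append K fun u v =>
    incr W s t v • incr W t s u • gammaWord f (u ++ (v ++ w)) φ (X t)]
  -- By Chen's relation W_ts ⋆ W_st = W_tt is the unit, so only the empty word survives.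
  have e : ∀ z ∈ wordsLE d K, ∑ k ∈ Finset.range (z.length + 1),
      incr W s t (z.drop k) • incr W t s (z.take k) •
        gammaWord f (z.take k ++ (z.drop k ++ w)) φ (X t) =
      counit z • gammaWord f (z ++ w) φ (X t) := by
    intro z hz
    rw [mem_wordsLE] at hz
    rw [← hW.incr_self ht (hz.trans hK), ← hW.conv_incr hs (hz.trans hK), conv, Finset.sum_smul]
    refine Finset.sum_congr rfl fun k _ => ?_
    rw [← List.append_assoc, List.take_append_drop, smul_smul, mul_comm]
  rw [Finset.sum_congr rfl e, sum_wordsLE_eq_add K fun z =>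
    counit z • gammaWord f (z ++ w) φ (X t), Finset.sum_eq_zero (s := nonemptyWords d K)]
  · simp
  · intro z hz
    simp [counit, (mem_nonemptyWords.1 hz).2]

end

end RoughIto

end

/-! ### The Itô–Davie formula. -/

theorem mainTheorem6 (n d : ℕ) (γ T : ℝ) (hγ : 0 < γ) (hγ_lt : γ < 1) (hT : 0 < T)
    (W : ℝ → RoughIto.Word d → ℝ) (hW : RoughIto.IsGeometricRoughPath γ T W)
    (f : Fin d → EuclideanSpace ℝ (Fin n) → EuclideanSpace ℝ (Fin n))
    (hf : ∀ i, ContDiff ℝ (RoughIto.level γ) (f i))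
    (x : EuclideanSpace ℝ (Fin n)) (X : ℝ → EuclideanSpace ℝ (Fin n))
    (hX : RoughIto.IsRDESolution γ T W f x X)
    (φ : EuclideanSpace ℝ (Fin n) → ℝ) (hφ : RoughIto.IsCb (RoughIto.level γ + 1) φ)
    (w : RoughIto.Word d) (hw : w.length ≤ RoughIto.level γ) :
    ∃ C : ℝ, ∀ s ∈ Set.Icc 0 T, ∀ t ∈ Set.Icc 0 T,
      |RoughIto.gammaWord f w φ (X t)
        - ∑ v ∈ RoughIto.wordsLE d (RoughIto.level γ - w.length),
            RoughIto.gammaWord f (v ++ w) φ (X s) * RoughIto.incr W s t v|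
        ≤ C * |t - s| ^ (((RoughIto.level γ : ℝ) + 1 - w.length) * γ) := by
  open RoughIto in
  obtain ⟨⟨R, hR⟩, hD⟩ := hX.davie hγ hγ_lt hT.le hW hf
  have hfwd : ∀ z : Word d, z.length ≤ level γ → ∃ C, ∀ p ∈ orderedPairs T,
      ‖gammaWord f z φ (X p.2) - ∑ v ∈ wordsLE d (level γ - z.length),
        incr W p.1 p.2 v • gammaWord f (v ++ z) φ (X p.1)‖ ≤
      C * ‖scale γ p ^ (level γ + 1 - z.length)‖ := fun z hz =>
    Asymptotics.isBigO_principal.1 (isBigO_gammaWord_sub hγ.le hW le_rfl hf hR hD hφ.1 hz)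
  have hinc : ∀ v : Word d, v.length ≤ level γ → ∃ C, ∀ s ∈ Set.Icc 0 T, ∀ t ∈ Set.Icc 0 T,
      |incr W s t v| ≤ C * (|t - s| ^ γ) ^ v.length := fun v hv => hW.incr_bound hv
  choose! A hA using hfwd
  choose! B hB using hinc
  set K := level γ - w.length with hK
  -- The first summand serves s < t, the sum serves t < s: there the coordinate at v has order |v|
  -- and the forward remainder at `v ++ w` has order K + 1 - |v|.
  refine ⟨|A w| + ∑ v ∈ wordsLE d K, |B v| * |A (v ++ w)|, fun s hs t ht => ?_⟩
  have hsc : |t - s| ^ (((level γ : ℝ) + 1 - w.length) * γ) = scale γ (s, t) ^ (K + 1) := by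
    rw [scale_pow, hK]
    push_cast [hw]
    ring_nf
  have hscale : 0 ≤ scale γ (s, t) := scale_nonneg _ _
  simp only [mul_comm (gammaWord f _ φ (X s)), ← smul_eq_mul (a := incr W s t _)]
  rw [hsc, ← Real.norm_eq_abs]
  rcases lt_trichotomy s t with h | h | h
  · have := hA w hw (s, t) ⟨hs.1, h, ht.2⟩
    rw [Real.norm_of_nonneg (pow_nonneg hscale _),
      show level γ + 1 - w.length = K + 1 by omega] at this
    refine this.trans (mul_le_mul_of_nonneg_right ?_ (pow_nonneg hscale _))
    exact (le_abs_self _).trans (le_add_of_nonneg_right (by positivity))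
  · subst h
    rw [sum_wordsLE_eq_add, (hW.incr_character hs hs).one, Finset.sum_eq_zero]
    · simp only [List.nil_append, one_smul, add_zero, sub_self, norm_zero]
      positivity
    · intro v hv
      rw [mem_nonemptyWords] at hv
      rw [hW.incr_self hs (by omega)]
      simp [counit, hv.2]
  · rw [sub_sum_incr_reverse hW hs ht φ (Nat.sub_le _ _) w, norm_neg]
    refine (norm_sum_le_of_le _ (n := fun v =>
      |B v| * |A (v ++ w)| * scale γ (s, t) ^ (K + 1)) fun v hv => ?_).trans ?_
    · rw [mem_wordsLE] at hv
      have hlen : (v ++ w).length = v.length + w.length := List.length_append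
      have h1 := hB v (by omega) s hs t ht
      have h2 := hA (v ++ w) (by omega) (t, s) ⟨ht.1, h, hs.2⟩
      have hsymm : scale γ (t, s) = scale γ (s, t) := by simp only [scale, abs_sub_comm]
      rw [hsymm, Real.norm_of_nonneg (pow_nonneg hscale _), hlen,
        show level γ - (v.length + w.length) = K - v.length by omega,
        show level γ + 1 - (v.length + w.length) = K + 1 - v.length by omega] at h2
      have h1' : ‖incr W s t v‖ ≤ |B v| * scale γ (s, t) ^ v.length :=
        h1.trans (mul_le_mul_of_nonneg_right (le_abs_self _) (pow_nonneg hscale _))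
      have h2' := h2.trans
        (mul_le_mul_of_nonneg_right (le_abs_self (A (v ++ w))) (pow_nonneg hscale _))
      rw [norm_smul, show K + 1 = v.length + (K + 1 - v.length) by omega, pow_add,
        mul_mul_mul_comm]
      exact mul_le_mul h1' h2' (norm_nonneg _) (by positivity)
    · rw [← Finset.sum_mul]
      exact mul_le_mul_of_nonneg_right (le_add_of_nonneg_left (abs_nonneg _))
        (pow_nonneg hscale _)
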